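/- The lower elementary functions $\mathbb N^n\to\mathbb N$ form the smallest class of functions that contains the constant functions, the projections, the successor function and the modified difference $\max\{0,x-y\}$, and is closed under composition and under bounded summation $f(\bar x,y)=\sum_{i=0}^{y}g(\bar x,i)$. A function $\mathbb N^n\to\mathbb N^m$ is lower elementary if all its components are. Identify $\mathbb Q$ with a retract of $\mathbb N^3$ through $\iota(z/n)=(\max(z,0),-\min(0,z),n)$, for $z/n$ in lowest terms with $n>0$, and $\pi(a,b,n)=(a-b)/n$ if $n>0$, $\pi(a,b,0)=0$; a function $f:\mathbb Q^N\times\mathbb N\to\mathbb Q^M$ is lower elementary if the function $\mathbb N^{3N+1}\to\mathbb N^{3M}$ obtained by composing $f$ with $\pi$ in each rational argument and with $\iota$ in each value is lower elementary. Let $|\cdot|$ be the maximum norm on $\mathbb R^N$. For an open set $O\subseteq\mathbb R^N$ and an integer $e\ge 1$, let $O_e$ be the set of all $x\in O$ with $|x|\le e$ and $\operatorname{dist}(x,\mathbb R^N\setminus O)\ge 1/e$ (the distance to $\emptyset$ being $\infty$). A function $F:O\to\mathbb R^M$ is called lower elementary on $O$ if there are lower elementary functions $d:\mathbb N\to\mathbb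 N$, strictly increasing, and $f:\mathbb Q^N\times\mathbb N\to\mathbb Q^M$ such that for all integers $e\ge1$, all $a\in\mathbb Q^N$ and all $x\in O_e$, $$|x-a|<\frac1{d(e)}\;\Longrightarrow\;|F(x)-f(a,e)|<\frac1e .$$ Complex functions are treated as functions between subsets of $\mathbb R^2$, identifying $\mathbb C$ with $\mathbb R^2$. Let $S=\{-n\mid n\in\mathbb N\}=\{0,-1,-2,\dots\}$ be the set of poles of the Gamma function $\Gamma$. Then for every real number $r$, $\Gamma$ is lower elementary on the open set $\{z\in\mathbb C:|z|<r\}\setminus S$, where here $|z|$ is the usual absolute value on $\mathbb C$. -/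

import Mathlib

namespace LowElem

/-- The lower elementary functions `ℕⁿ → ℕ`: the smallest class containing the constant functions,
the projections, the successor and the modified difference `x ∸ y = max (0, x - y)`, and closed
under composition and bounded summation `f (x̄, y) = ∑_{i=0}^{y} g (x̄, i)`. -/
inductive LowerElementary : {n : ℕ} → ((Fin n → ℕ) → ℕ) → Prop
  | const (n c : ℕ) : LowerElementary (fun _ : Fin n → ℕ => c)
  | proj {n : ℕ} (i : Fin n) : LowerElementary (fun v : Fin n → ℕ => v i)
  | succ : LowerElementary (fun v : Fin 1 → ℕ => v 0 + 1)
  | sub : LowerElementary (fun v : Fin 2 → ℕ => v 0 - v 1)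
  | comp {m n : ℕ} {g : (Fin m → ℕ) → ℕ} {h : Fin m → (Fin n → ℕ) → ℕ} :
      LowerElementary g → (∀ i, LowerElementary (h i)) →
        LowerElementary (fun v : Fin n → ℕ => g (fun i => h i v))
  | sum {n : ℕ} {g : (Fin (n + 1) → ℕ) → ℕ} :
      LowerElementary g →
        LowerElementary (fun v : Fin (n + 1) → ℕ =>
          ∑ i ∈ Finset.range (v (Fin.last n) + 1), g (Function.update v (Fin.last n) i))

/-- The embedding `ι : ℚ → ℕ³` by which `ℚ` is a retract of `ℕ³`: write `q = z / n` in lowest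
terms with `n > 0` and send `q` to `(max (z, 0), - min (0, z), n)`. -/
def ratEncode (q : ℚ) : Fin 3 → ℕ := ![q.num.toNat, (-q.num).toNat, q.den]

/-- The projection `π : ℕ³ → ℚ`, `(a, b, n) ↦ (a - b) / n` if `n > 0`, and `0` if `n = 0`. -/
def ratDecode (v : Fin 3 → ℕ) : ℚ := if 0 < v 2 then ((v 0 : ℚ) - (v 1 : ℚ)) / (v 2 : ℚ) else 0

/-- The projection `ℕ^(3N+1) → ℚ^N` obtained by decoding `N` consecutive triples (the last
coordinate is ignored). -/
def ratTupleDecode {N : ℕ} (v : Fin (3 * N + 1) → ℕ) : Fin N → ℚ := fun i =>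
  ratDecode ![v ⟨3 * i.1, by omega⟩, v ⟨3 * i.1 + 1, by omega⟩, v ⟨3 * i.1 + 2, by omega⟩]

/-- `d : ℕ → ℕ` is lower elementary. -/
def IsLowNat (d : ℕ → ℕ) : Prop := LowerElementary (fun v : Fin 1 → ℕ => d (v 0))

/-- `f : ℚ^N × ℕ → ℚ^M` is lower elementary, i.e. `ι ∘ f ∘ π : ℕ^(3N+1) → ℕ^(3M)` has lower
elementary components. -/
def IsLowRat {N M : ℕ} (f : (Fin N → ℚ) → ℕ → (Fin M → ℚ)) : Prop :=
  ∀ (j : Fin M) (k : Fin 3),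
    LowerElementary (fun v : Fin (3 * N + 1) → ℕ =>
      ratEncode (f (ratTupleDecode v) (v (Fin.last (3 * N))) j) k)

/-- The set `O_e` of all `x ∈ O` with `|x| ≤ e` and `dist (x, ℝ^N \ O) ≥ 1 / e`, for the maximum
norm, which is the norm of `Fin N → ℝ`. The distance to the empty set is infinite. -/
def exhaust {N : ℕ} (O : Set (Fin N → ℝ)) (e : ℕ) : Set (Fin N → ℝ) :=
  {x | x ∈ O ∧ ‖x‖ ≤ (e : ℝ) ∧ ∀ y, y ∉ O → 1 / (e : ℝ) ≤ dist x y}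

/-- `F : O → ℝ^M` is lower elementary on the open set `O ⊆ ℝ^N`: there are lower elementary
`d : ℕ → ℕ`, strictly increasing, and `f : ℚ^N × ℕ → ℚ^M` such that `|x - a| < 1 / d(e)` implies
`|F(x) - f(a, e)| < 1 / e` for all `e ≥ 1`, `a ∈ ℚ^N` and `x ∈ O_e`. Only the values of `F` on `O`
matter. -/
def IsLowOn {N M : ℕ} (O : Set (Fin N → ℝ)) (F : (Fin N → ℝ) → (Fin M → ℝ)) : Prop :=
  ∃ (d : ℕ → ℕ) (f : (Fin N → ℚ) → ℕ → (Fin M → ℚ)),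
    StrictMono d ∧ IsLowNat d ∧ IsLowRat f ∧
      ∀ e : ℕ, 1 ≤ e → ∀ a : Fin N → ℚ, ∀ x ∈ exhaust O e,
        ‖x - (fun i => (a i : ℝ))‖ < 1 / (d e : ℝ) →
          ‖F x - (fun j => (f a e j : ℝ))‖ < 1 / (e : ℝ)

/-- The identification of `ℂ` with `ℝ²`. -/
def toPlane (z : ℂ) : Fin 2 → ℝ := ![z.re, z.im]

/-- The inverse identification of `ℝ²` with `ℂ`. -/
def ofPlane (x : Fin 2 → ℝ) : ℂ := ⟨x 0, x 1⟩

/-- A complex function is lower elementary on the open set `O ⊆ ℂ` if it is so as a map from a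
subset of `ℝ²` to `ℝ²`. -/
def IsLowOnComplex (O : Set ℂ) (F : ℂ → ℂ) : Prop :=
  IsLowOn (ofPlane ⁻¹' O) (fun x => toPlane (F (ofPlane x)))

/-- The set `S = {-n | n ∈ ℕ}` of poles of the Gamma function. -/
def gammaPoles : Set ℂ := {z | ∃ n : ℕ, z = -(n : ℂ)}

end LowElem

/-! Lower elementary functions grow at most polynomially, but they allow bounded sums and bounded
search. A real quantity is therefore accessible once it is a limit, with error O(1/k), of sums of
polynomially many rationals of polynomial size. `LowR` captures this. It is closed under ring
operations, under bounded sums (after rounding the terms to one denominator) and under such limits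
(`LowR.of_lim`). Logarithm and arctangent are limits of Riemann sums. The exponential is found by
searching for an inverse of the logarithm, which requires an a priori bound on the value. For cosine
and sine one searches for u with 4 arctan u close to the angle modulo 2π, since cos (4 arctan u) and
sin (4 arctan u) are rational in u.

Gauss's product n! n^z / (z (z+1) ⋯ (z+n)) converges to Γ(z) with error C/n, uniformly for Re z ≥ 1
and |z| ≤ R. The factor n! is too large for the class, but a logarithm of the product is a sum of
logarithms and arctangents, and the product itself stays bounded, so it can be recovered by
`LowR.exp`, `LowR.cos` and `LowR.sin`. Applying Γ(z) = Γ(z+1)/z a fixed number m of times reaches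
every point of a bounded region off the poles.

It remains to replace x by a nearby rational point. On O_e the poles are at distance at least 1/e,
so Γ is bounded near x by a polynomial in e. The Schwarz lemma turns this into a Lipschitz constant
polynomial in e (`norm_gamma_sub_gamma_le`), hence into a polynomial d. Boundedness of the domain is
what keeps m, and so the degree, fixed. -/

namespace LowElem

/-! ### Closure properties of natural number functions -/

/-- A type whose elements are described by finitely many natural numbers. -/
class Context (α : Type) where
  /-- The number of coordinates. -/
  dim : ℕ
  /-- The coordinates of an element. -/
  coord : α → Fin dim → ℕ

open Context

instance Context.pi (n : ℕ) : Context (Fin n → ℕ) := ⟨n, id⟩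

instance Context.prodNat {α : Type} [Context α] : Context (α × ℕ) :=
  ⟨dim α + 1, fun a => Fin.snoc (α := fun _ => ℕ) (coord a.1) a.2⟩

variable {α β γ : Type} [Context α] [Context β] [Context γ]

/-- `f` is a lower elementary function of the coordinates. -/
def Low (f : α → ℕ) : Prop :=
  ∃ g : (Fin (dim α) → ℕ) → ℕ, LowerElementary g ∧ ∀ a, f a = g (coord a)

/-- A map whose coordinates are lower elementary. -/
def LowMap (φ : β → α) : Prop := ∀ i, Low (fun b => coord (φ b) i)

open Classical in
/-- A predicate with lower elementary characteristic function. -/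
def LowPred (p : α → Prop) : Prop := Low (fun a => if p a then 1 else 0)

theorem Low.congr {f g : α → ℕ} (hf : Low f) (h : ∀ a, g a = f a) : Low g := by
  obtain ⟨F, hF, e⟩ := hf
  exact ⟨F, hF, fun a => (h a).trans (e a)⟩

theorem Low.const (c : ℕ) : Low (fun _ : α => c) := ⟨_, .const _ c, fun _ => rfl⟩

theorem Low.coordinate (i : Fin (dim α)) : Low (fun a : α => coord a i) := ⟨_, .proj i, fun _ => rfl⟩

theorem Low.subst {f : α → ℕ} {φ : β → α} (hf : Low f) (hφ : LowMap φ) :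
    Low (fun b => f (φ b)) := by
  obtain ⟨g, hg, e⟩ := hf
  choose h hh eh using hφ
  refine ⟨_, hg.comp hh, fun b => ?_⟩
  beta_reduce
  rw [e]
  congr 1
  funext i
  exact eh i b

theorem LowMap.id : LowMap (fun a : α => a) := fun i => Low.coordinate i

theorem LowMap.comp {φ : β → α} {ψ : γ → β} (hφ : LowMap φ) (hψ : LowMap ψ) :
    LowMap (fun c => φ (ψ c)) := fun i => (hφ i).subst hψ

theorem LowMap.fst : LowMap (Prod.fst : α × ℕ → α) := fun i =>
  ⟨_, .proj (Fin.castSucc i), fun a => (Fin.snoc_castSucc (α := fun _ => ℕ) a.2 (coord a.1) i).symm⟩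

theorem Low.snd : Low (Prod.snd : α × ℕ → ℕ) :=
  ⟨_, .proj (Fin.last _), fun a => (Fin.snoc_last (α := fun _ => ℕ) a.2 (coord a.1)).symm⟩

theorem LowMap.pair {φ : β → α} {h : β → ℕ} (hφ : LowMap φ) (hh : Low h) :
    LowMap (fun b => (φ b, h b)) := by
  intro i
  refine Fin.lastCases ?_ (fun i => ?_) i
  · exact hh.congr fun b => Fin.snoc_last (α := fun _ => ℕ) _ _
  · exact (hφ i).congr fun b => Fin.snoc_castSucc (α := fun _ => ℕ) _ _ i

theorem Low.fst {f : α → ℕ} (hf : Low f) : Low (fun a : α × ℕ => f a.1) := hf.subst LowMap.fst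

theorem Low.succ {f : α → ℕ} (hf : Low f) : Low (fun a => f a + 1) := by
  obtain ⟨F, hF, e⟩ := hf
  exact ⟨_, LowerElementary.succ.comp (h := fun _ => F) fun _ => hF, fun a => by beta_reduce; rw [e]⟩

theorem Low.sub {f g : α → ℕ} (hf : Low f) (hg : Low g) : Low (fun a => f a - g a) := by
  obtain ⟨F, hF, e⟩ := hf
  obtain ⟨G, hG, e'⟩ := hg
  refine ⟨_, LowerElementary.sub.comp (h := ![F, G]) fun i => ?_, fun a => by simp [e, e']⟩
  fin_cases i
  · exact hF
  · exact hG

theorem Low.sum_range_succ {g : α × ℕ → ℕ} {b : α → ℕ} (hg : Low g) (hb : Low b) :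
    Low (fun a => ∑ i ∈ Finset.range (b a + 1), g (a, i)) := by
  obtain ⟨G, hG, e⟩ := hg
  have h : Low (fun w : α × ℕ => ∑ i ∈ Finset.range (w.2 + 1), g (w.1, i)) := by
    refine ⟨_, LowerElementary.sum hG, fun w => ?_⟩
    have : coord w = Fin.snoc (α := fun _ => ℕ) (coord w.1) w.2 := rfl
    rw [this, Fin.snoc_last]
    refine Finset.sum_congr rfl fun i _ => ?_
    rw [Fin.update_snoc_last, e]
    rfl
  exact h.subst (LowMap.id.pair hb)

theorem Low.mul {f g : α → ℕ} (hf : Low f) (hg : Low g) : Low (fun a => f a * g a) :=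
  -- Summing the constant f over 0 ≤ i ≤ g gives f (g + 1).
  ((hf.fst.sum_range_succ hg).sub hf).congr fun a => by
    simp [Nat.mul_succ, mul_comm]

theorem Low.add {f g : α → ℕ} (hf : Low f) (hg : Low g) : Low (fun a => f a + g a) :=
  (((hf.succ.mul hg.succ).sub (Low.const 1)).sub (hf.mul hg)).congr fun a => by
    have : (f a + 1) * (g a + 1) = f a * g a + (f a + g a) + 1 := by ring
    omega

theorem Low.pow {f : α → ℕ} (hf : Low f) (n : ℕ) : Low (fun a => f a ^ n) := by
  induction n with
  | zero => simpa using Low.const 1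
  | succ n ih => exact (ih.mul hf).congr fun a => pow_succ _ _

theorem Low.sum_range {g : α × ℕ → ℕ} {b : α → ℕ} (hg : Low g) (hb : Low b) :
    Low (fun a => ∑ i ∈ Finset.range (b a), g (a, i)) :=
  ((hg.sum_range_succ hb).sub (hg.subst (LowMap.id.pair hb))).congr fun a => by
    rw [Finset.sum_range_succ]; simp

/-! ### Predicates, bounded search and division -/

theorem LowPred.congr {p q : α → Prop} (hp : LowPred p) (h : ∀ a, q a ↔ p a) : LowPred q := by
  obtain rfl : q = p := funext fun a => propext (h a)
  exact hp

theorem LowPred.subst {p : α → Prop} {φ : β → α} (hp : LowPred p) (hφ : LowMap φ) :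
    LowPred (fun b => p (φ b)) := Low.subst hp hφ

theorem Low.eq_zero {f : α → ℕ} (hf : Low f) : LowPred (fun a => f a = 0) :=
  ((Low.const 1).sub hf).congr fun a => by
    by_cases h : f a = 0
    · simp [h]
    · simp [h]; omega

theorem Low.le {f g : α → ℕ} (hf : Low f) (hg : Low g) : LowPred (fun a => f a ≤ g a) :=
  (hf.sub hg).eq_zero.congr fun a => by omega

theorem LowPred.not {p : α → Prop} (hp : LowPred p) : LowPred (fun a => ¬ p a) :=
  (Low.eq_zero hp).congr fun a => by simp

theorem LowPred.and {p q : α → Prop} (hp : LowPred p) (hq : LowPred q) :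
    LowPred (fun a => p a ∧ q a) :=
  (Low.mul hp hq).congr fun a => by
    by_cases h : p a <;> by_cases h' : q a <;> simp [h, h']

theorem Low.lt {f g : α → ℕ} (hf : Low f) (hg : Low g) : LowPred (fun a => f a < g a) :=
  (hf.succ.le hg).congr fun _ => Iff.rfl

theorem Low.ite {p : α → Prop} {f g : α → ℕ} [∀ a, Decidable (p a)] (hp : LowPred p) (hf : Low f)
    (hg : Low g) : Low (fun a => if p a then f a else g a) :=
  ((Low.mul hp hf).add (Low.mul hp.not hg)).congr fun a => by
    by_cases h : p a <;> simp [h]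

theorem LowPred.ball {p : α × ℕ → Prop} {b : α → ℕ} (hp : LowPred p) (hb : Low b) :
    LowPred (fun a => ∀ i < b a, p (a, i)) :=
  (Low.eq_zero (Low.sum_range hp.not hb)).congr fun a => by
    simp [Finset.sum_eq_zero_iff]

/-- Bounded search for the least solution. -/
theorem LowPred.exists_least {p : α × ℕ → Prop} {b : α → ℕ} (hp : LowPred p) (hb : Low b) :
    ∃ s : α → ℕ, Low s ∧ ∀ a, (∀ j < s a, ¬ p (a, j)) ∧ ((∃ i < b a, p (a, i)) → p (a, s a)) := by
  classical
  have h : LowPred (fun w : α × ℕ => ∀ j < w.2 + 1, ¬ p (w.1, j)) :=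
    LowPred.ball (p := fun w : (α × ℕ) × ℕ => ¬ p (w.1.1, w.2))
      (hp.not.subst ((LowMap.fst.comp LowMap.fst).pair Low.snd)) Low.snd.succ
  -- The sum counts the i < b a such that no j ≤ i is a solution. It equals the least solution below
  -- b a, or b a if there is none.
  refine ⟨_, Low.sum_range h hb, fun a => ?_⟩
  beta_reduce
  have key : ∀ n, (∀ j < ∑ i ∈ Finset.range n, (if ∀ j < i + 1, ¬ p (a, j) then 1 else 0),
        ¬ p (a, j)) ∧ ((∃ i < n, p (a, i)) →
          p (a, ∑ i ∈ Finset.range n, (if ∀ j < i + 1, ¬ p (a, j) then 1 else 0))) ∧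
        ((∀ i < n, ¬ p (a, i)) →
          ∑ i ∈ Finset.range n, (if ∀ j < i + 1, ¬ p (a, j) then 1 else 0) = n) := by
    intro n
    induction n with
    | zero => simp
    | succ n ih =>
      rw [Finset.sum_range_succ]
      obtain ⟨h1, h2, h3⟩ := ih
      by_cases hn : ∀ j < n + 1, ¬ p (a, j)
      · rw [if_pos hn, h3 fun i hi => hn i (by omega)]
        refine ⟨hn, fun ⟨i, hi, hpi⟩ => absurd hpi (hn i hi), fun _ => rfl⟩
      · rw [if_neg hn, add_zero]
        refine ⟨h1, fun _ => ?_, fun h => absurd h hn⟩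
        by_cases he : ∃ i < n, p (a, i)
        · exact h2 he
        · push Not at he hn
          rw [h3 he]
          obtain ⟨j, hj, hpj⟩ := hn
          rcases Nat.lt_succ_iff_lt_or_eq.mp hj with h | h
          · exact absurd hpj (he j h)
          · exact h ▸ hpj
  have := key (b a)
  exact ⟨by convert this.1, by convert this.2.1⟩

/-- The quotient is the least s with f < (s + 1) g, and it is at most f, which bounds the search. -/
theorem Low.div {f g : α → ℕ} (hf : Low f) (hg : Low g) : Low (fun a => f a / g a) := by
  obtain ⟨s, hs, h⟩ := LowPred.exists_least
    (p := fun w : α × ℕ => g w.1 = 0 ∨ f w.1 < (w.2 + 1) * g w.1) (b := fun a => f a + 1)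
    (((hg.fst.eq_zero.not.and (hf.fst.lt (Low.snd.succ.mul hg.fst)).not).not).congr
      fun w => by tauto) hf.succ
  refine (Low.ite hg.eq_zero (Low.const 0) hs).congr fun a => ?_
  split_ifs with h0
  · simp [h0]
  · obtain ⟨h1, h2⟩ := h a
    have hpos : 0 < g a := Nat.pos_of_ne_zero h0
    have h3 := h2 ⟨f a, by omega, Or.inr (by
      show f a < (f a + 1) * g a
      nlinarith)⟩
    simp only [h0, false_or] at h1 h3
    refine Nat.div_eq_of_lt_le ?_ h3
    rcases Nat.eq_zero_or_pos (s a) with hz | hz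
    · simp [hz]
    · have := h1 (s a - 1) (by omega)
      rw [Nat.sub_add_cancel hz] at this
      omega

theorem Low.mod {f g : α → ℕ} (hf : Low f) (hg : Low g) : Low (fun a => f a % g a) :=
  (hf.sub (hg.mul (hf.div hg))).congr fun a => by
    have := Nat.div_add_mod (f a) (g a)
    omega

/-! ### Exact rational sequences -/

/-- An exactly given sequence of rational numbers. -/
def LowQ (f : α → ℝ) : Prop :=
  ∃ p q d : α → ℕ, Low p ∧ Low q ∧ Low d ∧ ∀ a, 0 < d a ∧ f a = ((p a : ℝ) - q a) / d a

theorem LowQ.congr {f g : α → ℝ} (hf : LowQ f) (h : ∀ a, g a = f a) : LowQ g := by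
  obtain ⟨p, q, d, hp, hq, hd, e⟩ := hf
  exact ⟨p, q, d, hp, hq, hd, fun a => ⟨(e a).1, (h a).trans (e a).2⟩⟩

theorem LowQ.subst {f : α → ℝ} {φ : β → α} (hf : LowQ f) (hφ : LowMap φ) :
    LowQ (fun b => f (φ b)) := by
  obtain ⟨p, q, d, hp, hq, hd, e⟩ := hf
  exact ⟨_, _, _, hp.subst hφ, hq.subst hφ, hd.subst hφ, fun b => e (φ b)⟩

theorem LowQ.fst {f : α → ℝ} (hf : LowQ f) : LowQ (fun a : α × ℕ => f a.1) := hf.subst LowMap.fst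

theorem Low.lowQ {f : α → ℕ} (hf : Low f) : LowQ (fun a => (f a : ℝ)) :=
  ⟨f, _, _, hf, Low.const 0, Low.const 1, fun a => by simp⟩

theorem LowQ.natCast (n : ℕ) : LowQ (fun _ : α => (n : ℝ)) := (Low.const n).lowQ

theorem LowQ.neg {f : α → ℝ} (hf : LowQ f) : LowQ (fun a => -f a) := by
  obtain ⟨p, q, d, hp, hq, hd, e⟩ := hf
  exact ⟨q, p, d, hq, hp, hd, fun a => ⟨(e a).1, by beta_reduce; rw [(e a).2]; ring⟩⟩

theorem LowQ.add {f g : α → ℝ} (hf : LowQ f) (hg : LowQ g) : LowQ (fun a => f a + g a) := by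
  obtain ⟨p, q, d, hp, hq, hd, e⟩ := hf
  obtain ⟨p', q', d', hp', hq', hd', e'⟩ := hg
  refine ⟨_, _, _, (hp.mul hd').add (hp'.mul hd), (hq.mul hd').add (hq'.mul hd), hd.mul hd',
    fun a => ?_⟩
  obtain ⟨h, E⟩ := e a
  obtain ⟨h', E'⟩ := e' a
  refine ⟨Nat.mul_pos h h', ?_⟩
  beta_reduce
  rw [E, E']
  push_cast
  field_simp
  ring

theorem LowQ.sub {f g : α → ℝ} (hf : LowQ f) (hg : LowQ g) : LowQ (fun a => f a - g a) :=
  (hf.add hg.neg).congr fun _ => sub_eq_add_neg _ _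

theorem LowQ.mul {f g : α → ℝ} (hf : LowQ f) (hg : LowQ g) : LowQ (fun a => f a * g a) := by
  obtain ⟨p, q, d, hp, hq, hd, e⟩ := hf
  obtain ⟨p', q', d', hp', hq', hd', e'⟩ := hg
  refine ⟨_, _, _, (hp.mul hp').add (hq.mul hq'), (hp.mul hq').add (hq.mul hp'), hd.mul hd',
    fun a => ?_⟩
  obtain ⟨h, E⟩ := e a
  obtain ⟨h', E'⟩ := e' a
  refine ⟨Nat.mul_pos h h', ?_⟩
  beta_reduce
  rw [E, E']
  push_cast
  field_simp
  ring

theorem LowQ.exists_reduced {f : α → ℝ} (hf : LowQ f) :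
    ∃ p q d : α → ℕ, Low p ∧ Low q ∧ Low d ∧
      ∀ a, 0 < d a ∧ (p a = 0 ∨ q a = 0) ∧ f a = ((p a : ℝ) - q a) / d a := by
  obtain ⟨p, q, d, hp, hq, hd, e⟩ := hf
  refine ⟨_, _, d, hp.sub hq, hq.sub hp, hd, fun a => ⟨(e a).1, by omega, ?_⟩⟩
  rw [(e a).2]
  rcases le_total (p a) (q a) with h | h
  · rw [Nat.sub_eq_zero_of_le h, Nat.cast_sub h]; simp
  · rw [Nat.sub_eq_zero_of_le h, Nat.cast_sub h]; simp

/-- In reduced form one of p, q vanishes, so p + q = |p - q| can serve as the new denominator while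
d goes to the side of the nonzero part. The value 0 is sent to 0, as in Lean. -/
theorem LowQ.inv {f : α → ℝ} (hf : LowQ f) : LowQ (fun a => (f a)⁻¹) := by
  classical
  obtain ⟨p, q, d, hp, hq, hd, e⟩ := hf.exists_reduced
  refine ⟨_, _, _, Low.ite hp.eq_zero (Low.const 0) hd, Low.ite hq.eq_zero (Low.const 0) hd,
    Low.ite (hp.add hq).eq_zero (Low.const 1) (hp.add hq), fun a => ?_⟩
  obtain ⟨h, h0, E⟩ := e a
  constructor
  · split_ifs <;> omega
  · beta_reduce
    rw [E]
    rcases h0 with h0 | h0 <;> by_cases h1 : p a = 0 <;> by_cases h2 : q a = 0 <;>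
      simp_all [neg_div]

theorem LowQ.div {f g : α → ℝ} (hf : LowQ f) (hg : LowQ g) : LowQ (fun a => f a / g a) :=
  (hf.mul hg.inv).congr fun _ => div_eq_mul_inv _ _

theorem LowQ.le {f g : α → ℝ} (hf : LowQ f) (hg : LowQ g) : LowPred (fun a => f a ≤ g a) := by
  obtain ⟨p, q, d, hp, hq, hd, e⟩ := hg.sub hf
  refine (hq.le hp).congr fun a => ?_
  obtain ⟨h, E⟩ := e a
  have hd' : (0 : ℝ) < d a := by exact_mod_cast h
  beta_reduce at E
  rw [← sub_nonneg, E, ← Nat.cast_le (α := ℝ), ← sub_nonneg (b := (q a : ℝ))]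
  exact ⟨fun h => by simpa [hd'.ne'] using mul_nonneg h hd'.le, fun h => div_nonneg h hd'.le⟩

/-! ### Real sequences with rational approximations -/

/-- A sequence of real numbers with lower elementary rational approximations. -/
def LowR (F : α → ℝ) : Prop :=
  ∃ f : α × ℕ → ℝ, LowQ f ∧ ∀ a k, |F a - f (a, k)| ≤ 1 / (k + 1)

theorem LowR.congr {F G : α → ℝ} (hF : LowR F) (h : ∀ a, G a = F a) : LowR G := by
  obtain ⟨f, hf, e⟩ := hF
  exact ⟨f, hf, fun a k => by rw [h]; exact e a k⟩

theorem LowR.subst {F : α → ℝ} {φ : β → α} (hF : LowR F) (hφ : LowMap φ) :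
    LowR (fun b => F (φ b)) := by
  obtain ⟨f, hf, e⟩ := hF
  exact ⟨_, hf.subst ((hφ.comp LowMap.fst).pair Low.snd), fun b k => e (φ b) k⟩

theorem LowR.fst {F : α → ℝ} (hF : LowR F) : LowR (fun a : α × ℕ => F a.1) := hF.subst LowMap.fst

theorem LowQ.lowR {f : α → ℝ} (hf : LowQ f) : LowR f :=
  ⟨_, hf.fst, fun a k => by
    rw [sub_self, abs_zero]
    positivity⟩

theorem LowQ.exists_bound {f : α → ℝ} (hf : LowQ f) : ∃ B : α → ℕ, Low B ∧ ∀ a, |f a| ≤ B a := by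
  obtain ⟨p, q, d, hp, hq, hd, e⟩ := hf
  refine ⟨_, hp.add hq, fun a => ?_⟩
  obtain ⟨h, E⟩ := e a
  have hd1 : (1 : ℝ) ≤ d a := by exact_mod_cast h
  have hp0 : (0 : ℝ) ≤ p a := by positivity
  have hq0 : (0 : ℝ) ≤ q a := by positivity
  rw [E, abs_div, Nat.abs_cast]
  refine (div_le_self (abs_nonneg _) hd1).trans ?_
  push_cast
  rw [abs_le]
  constructor <;> linarith

theorem LowR.exists_bound {F : α → ℝ} (hF : LowR F) : ∃ B : α → ℕ, Low B ∧ ∀ a, |F a| ≤ B a := by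
  obtain ⟨f, hf, e⟩ := hF
  obtain ⟨B, hB, h⟩ := hf.exists_bound
  refine ⟨_, (hB.subst (LowMap.id.pair (Low.const 0))).succ, fun a => ?_⟩
  have h1 := e a 0
  have h2 := h (a, 0)
  have h3 := abs_sub_abs_le_abs_sub (F a) (f (a, 0))
  push_cast at *
  norm_num at h1
  linarith

/-- Closure under limits with lower elementary rate of convergence. -/
theorem LowR.of_lim {F : α → ℝ} {G : α × ℕ → ℝ} {B : α → ℕ} (hG : LowR G) (hB : Low B)
    (h : ∀ a k, |F a - G (a, k)| ≤ B a / (k + 1)) : LowR F := by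
  obtain ⟨g, hg, e⟩ := hG
  have hK : Low (fun w : α × ℕ => (B w.1 + 1) * (w.2 + 1)) := hB.fst.succ.mul Low.snd.succ
  -- With limit index and precision both K = (B + 1)(k + 1), the total error is at most (B + 1)/(K +
  -- 1) ≤ 1/(k + 1).
  refine ⟨_, hg.subst ((LowMap.fst.pair hK).pair hK), fun a k => ?_⟩
  have h1 := h a ((B a + 1) * (k + 1))
  have h2 := e (a, (B a + 1) * (k + 1)) ((B a + 1) * (k + 1))
  have h3 := abs_sub_le (F a) (G (a, (B a + 1) * (k + 1)))
    (g ((a, (B a + 1) * (k + 1)), (B a + 1) * (k + 1)))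
  refine (h3.trans (add_le_add h1 h2)).trans ?_
  push_cast
  rw [← add_div, div_le_div_iff₀ (by positivity) (by positivity)]
  linarith

theorem LowR.of_approx {F : α → ℝ} {g : α × ℕ → ℝ} {B : α → ℕ} (hg : LowQ g) (hB : Low B)
    (h : ∀ a k, |F a - g (a, k)| ≤ B a / (k + 1)) : LowR F := LowR.of_lim hg.lowR hB h

theorem LowR.add {F G : α → ℝ} (hF : LowR F) (hG : LowR G) : LowR (fun a => F a + G a) := by
  obtain ⟨f, hf, e⟩ := hF
  obtain ⟨g, hg, e'⟩ := hG
  refine LowR.of_approx (hf.add hg) (Low.const 2) fun a k => ?_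
  have h := (abs_add_le _ _).trans (add_le_add (e a k) (e' a k))
  calc _ = |F a - f (a, k) + (G a - g (a, k))| := by congr 1; ring
    _ ≤ _ := h
    _ = _ := by push_cast; ring

theorem LowR.neg {F : α → ℝ} (hF : LowR F) : LowR (fun a => -F a) := by
  obtain ⟨f, hf, e⟩ := hF
  refine ⟨_, hf.neg, fun a k => ?_⟩
  rw [neg_sub_neg, abs_sub_comm]
  exact e a k

theorem LowR.sub {F G : α → ℝ} (hF : LowR F) (hG : LowR G) : LowR (fun a => F a - G a) :=
  (hF.add hG.neg).congr fun _ => sub_eq_add_neg _ _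

theorem LowR.mul {F G : α → ℝ} (hF : LowR F) (hG : LowR G) : LowR (fun a => F a * G a) := by
  obtain ⟨A, hA, eA⟩ := hF.exists_bound
  obtain ⟨B, hB, eB⟩ := hG.exists_bound
  obtain ⟨f, hf, e⟩ := hF
  obtain ⟨g, hg, e'⟩ := hG
  refine LowR.of_approx (hf.mul hg) (hA.add hB).succ fun a k => ?_
  have hk : (1 : ℝ) / (k + 1) ≤ 1 := by
    rw [div_le_one (by positivity)]
    linarith [(Nat.cast_nonneg k : (0 : ℝ) ≤ k)]
  have hg1 : |g (a, k)| ≤ B a + 1 := by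
    have := abs_sub_abs_le_abs_sub (g (a, k)) (G a)
    rw [abs_sub_comm] at this
    linarith [e' a k, eB a]
  calc |F a * G a - f (a, k) * g (a, k)|
      = |F a * (G a - g (a, k)) + (F a - f (a, k)) * g (a, k)| := by congr 1; ring
    _ ≤ |F a| * |G a - g (a, k)| + |F a - f (a, k)| * |g (a, k)| := by
      rw [← abs_mul, ← abs_mul]
      exact abs_add_le _ _
    _ ≤ A a * (1 / (k + 1)) + 1 / (k + 1) * (B a + 1) := by
      gcongr
      · exact eA a
      · exact e' a k
      · exact e a k
    _ = _ := by push_cast; ring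

theorem abs_div_sub_natFloor_div_le (p d k : ℕ) (hd : 0 < d) :
    0 ≤ (p : ℝ) / d - (p * (k + 1) / d : ℕ) / (k + 1) ∧
      (p : ℝ) / d - (p * (k + 1) / d : ℕ) / (k + 1) ≤ 1 / (k + 1) := by
  have hd' : (0 : ℝ) < d := by exact_mod_cast hd
  have h1 : ((p * (k + 1) / d : ℕ) : ℝ) * d ≤ p * (k + 1) := by
    exact_mod_cast Nat.div_mul_le_self (p * (k + 1)) d
  have h2 : (p : ℝ) * (k + 1) ≤ ((p * (k + 1) / d : ℕ) + 1) * d := by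
    have := (Nat.lt_mul_div_succ (p * (k + 1)) hd).le
    rw [mul_comm d] at this
    exact_mod_cast this
  constructor
  · rw [sub_nonneg, div_le_div_iff₀ (by positivity) hd']
    exact h1
  · rw [sub_le_iff_le_add, ← add_div, div_le_div_iff₀ hd' (by positivity)]
    linarith

/-- Multiplying the denominators of a long sum would exceed polynomial growth. Rounding every term
to denominator k + 1 reduces bounded sums of reals to bounded sums of natural numbers. -/
theorem LowR.exists_approx_common_den {F : α → ℝ} (hF : LowR F) :
    ∃ p q : α × ℕ → ℕ, Low p ∧ Low q ∧
      ∀ a k, |F a - ((p (a, k) : ℝ) - q (a, k)) / (k + 1)| ≤ 2 / (k + 1) := by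
  obtain ⟨f, ⟨p, q, d, hp, hq, hd, e⟩, h⟩ := hF
  refine ⟨_, _, (hp.mul Low.snd.succ).div hd, (hq.mul Low.snd.succ).div hd, fun a k => ?_⟩
  obtain ⟨hd, E⟩ := e (a, k)
  have h0 := abs_le.mp (h a k)
  have h1 := abs_div_sub_natFloor_div_le (p (a, k)) (d (a, k)) k hd
  have h2 := abs_div_sub_natFloor_div_le (q (a, k)) (d (a, k)) k hd
  have h3 : (2 : ℝ) / (k + 1) = 1 / (k + 1) + 1 / (k + 1) := by ring
  rw [E, sub_div] at h0
  rw [sub_div, h3, abs_le]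
  -- The two floor errors lie in [0, 1/(k+1)] and enter with opposite signs, so together they cost
  -- only one 1/(k+1).
  constructor <;> linarith [h0.1, h0.2, h1.1, h1.2, h2.1, h2.2]

theorem LowR.sum_range {F : α × ℕ → ℝ} {b : α → ℕ} (hF : LowR F) (hb : Low b) :
    LowR (fun a => ∑ i ∈ Finset.range (b a), F (a, i)) := by
  obtain ⟨p, q, hp, hq, e⟩ := hF.exists_approx_common_den
  have hswap : LowMap (fun w : (α × ℕ) × ℕ => ((w.1.1, w.2), w.1.2)) :=
    ((LowMap.fst.comp LowMap.fst).pair Low.snd).pair (Low.snd.subst LowMap.fst)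
  refine LowR.of_approx ((((hp.subst hswap).sum_range hb.fst).lowQ.sub
    ((hq.subst hswap).sum_range hb.fst).lowQ).div Low.snd.succ.lowQ)
    ((Low.const 2).mul hb) fun a k => ?_
  push_cast
  rw [← Finset.sum_sub_distrib, Finset.sum_div, ← Finset.sum_sub_distrib]
  refine (Finset.abs_sum_le_sum_abs _ _).trans ((Finset.sum_le_sum fun i _ => e (a, i) k).trans ?_)
  rw [Finset.sum_const, Finset.card_range, nsmul_eq_mul]
  exact le_of_eq (by ring)

/-! ### Logarithm and arctangent by Riemann sums -/

/-- From 1/(x+1) ≤ log ((x+1)/x) ≤ 1/x, with telescoping of the differences of the two bounds. -/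
theorem log_sub_sum_mem {K : ℕ} (hK : 1 ≤ K) (n : ℕ) :
    0 ≤ Real.log ((K + n : ℝ) / K) - ∑ j ∈ Finset.range n, 1 / (K + j + 1 : ℝ) ∧
      Real.log ((K + n : ℝ) / K) - ∑ j ∈ Finset.range n, 1 / (K + j + 1 : ℝ) ≤
        1 / K - 1 / (K + n) := by
  have hK' : (0 : ℝ) < K := by exact_mod_cast hK
  induction n with
  | zero => simp [hK'.ne']
  | succ n ih =>
    have hpos : (0 : ℝ) < K + n := by positivity
    have hx : (0 : ℝ) < (K + n + 1) / (K + n) := by positivity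
    have e : Real.log ((K + (n + 1 : ℕ) : ℝ) / K) =
        Real.log ((K + n : ℝ) / K) + Real.log ((K + n + 1) / (K + n)) := by
      rw [← Real.log_mul (by positivity) (by positivity)]
      congr 1
      push_cast
      field_simp
      ring
    have h1 := Real.log_le_sub_one_of_pos hx
    have h2 := Real.one_sub_inv_le_log_of_pos hx
    have e1 : (K + n + 1 : ℝ) / (K + n) - 1 = 1 / (K + n) := by field_simp; ring
    have e2 : 1 - ((K + n + 1 : ℝ) / (K + n))⁻¹ = 1 / (K + n + 1) := by field_simp; ring
    rw [e1] at h1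
    rw [e2] at h2
    rw [Finset.sum_range_succ, e]
    push_cast
    rw [← add_assoc]
    constructor <;> linarith [ih.1, ih.2]

theorem Low.log {m : α → ℕ} (hm : Low m) : LowR (fun a => Real.log (m a)) := by
  have hsum : LowR (fun w : α × ℕ => ∑ j ∈ Finset.range ((m w.1 - 1) * (w.2 + 1)),
      (1 / ((w.2 + 1 : ℕ) + j + 1 : ℝ))) :=
    LowR.sum_range (F := fun w : (α × ℕ) × ℕ => (1 / ((w.1.2 + 1 : ℕ) + w.2 + 1 : ℝ)))
      ((LowQ.natCast 1).div (((Low.snd.subst LowMap.fst).succ.add Low.snd).succ.lowQ)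
        |>.congr fun w => by push_cast; rfl).lowR
      ((hm.fst.sub (Low.const 1)).mul Low.snd.succ)
  -- With K = k + 1 and n = (m - 1) K the quotient (K + n)/K is m. For m = 0 the truncated
  -- subtraction gives the empty sum, matching `Real.log 0 = 0`.
  refine LowR.of_lim hsum (Low.const 1) fun a k => ?_
  rcases Nat.eq_zero_or_pos (m a) with h | h
  · simp [h]; positivity
  · have := log_sub_sum_mem (K := k + 1) (by omega) ((m a - 1) * (k + 1))
    have e : (((k + 1 : ℕ) : ℝ) + ((m a - 1) * (k + 1) : ℕ)) / (k + 1 : ℕ) = m a := by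
      push_cast [Nat.cast_sub h]
      field_simp
      ring
    rw [e] at this
    rw [abs_of_nonneg this.1]
    refine this.2.trans ?_
    have : (0 : ℝ) ≤ 1 / ((k + 1 : ℕ) + ((m a - 1) * (k + 1) : ℕ)) := by positivity
    push_cast at *
    linarith

theorem LowQ.log {f : α → ℝ} (hf : LowQ f) (h : ∀ a, 0 < f a) : LowR (fun a => Real.log (f a)) := by
  obtain ⟨p, q, d, hp, hq, hd, e⟩ := hf
  refine ((hp.sub hq).log.sub hd.log).congr fun a => ?_
  obtain ⟨h1, h2⟩ := e a
  have hd' : (0 : ℝ) < d a := by exact_mod_cast h1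
  have h3 : 0 < (p a : ℝ) - q a := by
    have := h a
    rw [h2] at this
    exact (div_pos_iff_of_pos_right hd').mp this
  have h4 : q a ≤ p a := by exact_mod_cast (sub_pos.mp h3).le
  rw [h2, Real.log_div h3.ne' hd'.ne', Nat.cast_sub h4]

/-- Mean value theorem: on [0, ∞) the derivative 1/(1 + x²) is decreasing and 1-Lipschitz. -/
theorem abs_arctan_add_sub_arctan_sub_le {t h : ℝ} (ht : 0 ≤ t) (hh : 0 < h) :
    |Real.arctan (t + h) - Real.arctan t - h / (1 + t ^ 2)| ≤ h ^ 2 := by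
  obtain ⟨x, hx, e⟩ := exists_hasDerivAt_eq_slope Real.arctan (fun x => 1 / (1 + x ^ 2))
    (show t < t + h by linarith) Real.continuous_arctan.continuousOn
    (fun x _ => Real.hasDerivAt_arctan x)
  rw [add_sub_cancel_left, eq_div_iff hh.ne'] at e
  have h1 : 0 ≤ 1 / (1 + t ^ 2) - 1 / (1 + x ^ 2) ∧ 1 / (1 + t ^ 2) - 1 / (1 + x ^ 2) ≤ h := by
    have hxt : 0 ≤ x - t := by linarith [hx.1]
    have e2 : 1 / (1 + t ^ 2) - 1 / (1 + x ^ 2) =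
        (x - t) * ((x + t) / ((1 + t ^ 2) * (1 + x ^ 2))) := by
      field_simp
      ring
    have h0 : 0 ≤ (x + t) / ((1 + t ^ 2) * (1 + x ^ 2)) := by
      have : 0 ≤ x + t := by linarith
      positivity
    have h3 : (x + t) / ((1 + t ^ 2) * (1 + x ^ 2)) ≤ 1 := by
      rw [div_le_one (by positivity)]
      nlinarith [sq_nonneg (x - 1), sq_nonneg (t - 1), sq_nonneg (x * t), sq_nonneg (x + t - 1)]
    rw [e2]
    exact ⟨mul_nonneg hxt h0, (mul_le_mul (by linarith [hx.2] : x - t ≤ h) h3 h0 hh.le).trans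
      (by rw [mul_one])⟩
  have e3 : Real.arctan (t + h) - Real.arctan t - h / (1 + t ^ 2) =
      -(h * (1 / (1 + t ^ 2) - 1 / (1 + x ^ 2))) := by
    rw [← e]; ring
  rw [e3, abs_neg, abs_of_nonneg (mul_nonneg hh.le h1.1), sq h]
  exact mul_le_mul_of_nonneg_left h1.2 hh.le

theorem abs_arctan_sub_sum_le {h : ℝ} (hh : 0 < h) (n : ℕ) :
    |Real.arctan (n * h) - ∑ j ∈ Finset.range n, h / (1 + (j * h) ^ 2)| ≤ n * h ^ 2 := by
  induction n with
  | zero => simp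
  | succ n ih =>
    have h1 := abs_arctan_add_sub_arctan_sub_le (t := n * h) (by positivity) hh
    rw [Finset.sum_range_succ, Nat.cast_succ, add_mul, one_mul]
    refine le_trans (le_of_eq ?_) ((abs_add_le _ _).trans (add_le_add ih h1)) |>.trans ?_
    · congr 1; ring
    · exact le_of_eq (by ring)

theorem Low.arctan_div {p d : α → ℕ} (hp : Low p) (hd : Low d) (h : ∀ a, 0 < d a) :
    LowR (fun a => Real.arctan (p a / d a)) := by
  have hh : LowQ (fun w : (α × ℕ) × ℕ => 1 / ((d w.1.1 : ℝ) * (w.1.2 + 1 : ℕ))) :=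
    (LowQ.natCast 1).div (hd.fst.mul Low.snd.succ).fst.lowQ |>.congr fun w => by push_cast; rfl
  have hsum : LowR (fun w : α × ℕ => ∑ j ∈ Finset.range (p w.1 * (w.2 + 1)),
      (1 / ((d w.1 : ℝ) * (w.2 + 1 : ℕ))) /
        (1 + (j * (1 / ((d w.1 : ℝ) * (w.2 + 1 : ℕ)))) ^ 2)) :=
    LowR.sum_range (F := fun w : (α × ℕ) × ℕ => (1 / ((d w.1.1 : ℝ) * (w.1.2 + 1 : ℕ))) /
        (1 + (w.2 * (1 / ((d w.1.1 : ℝ) * (w.1.2 + 1 : ℕ)))) ^ 2))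
      ((hh.div ((LowQ.natCast 1).add ((Low.snd.lowQ.mul hh).mul (Low.snd.lowQ.mul hh))))
        |>.congr fun w => by rw [sq, Nat.cast_one]).lowR
      (hp.fst.mul Low.snd.succ)
  -- The p (k + 1) steps of width h = 1/(d (k + 1)) end at p/d, with error p (k + 1) h² ≤ p/(k + 1).
  refine LowR.of_lim hsum hp fun a k => ?_
  have hd1 : (1 : ℝ) ≤ d a := by exact_mod_cast h a
  have := abs_arctan_sub_sum_le (h := 1 / ((d a : ℝ) * (k + 1 : ℕ))) (by positivity)
    (p a * (k + 1))
  have e : ((p a * (k + 1) : ℕ) : ℝ) * (1 / ((d a : ℝ) * (k + 1 : ℕ))) = p a / d a := by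
    push_cast
    field_simp
  rw [e] at this
  refine this.trans ?_
  calc _ = (p a / (k + 1) : ℝ) / (d a) ^ 2 := by push_cast; field_simp
    _ ≤ _ := div_le_self (by positivity) (by nlinarith)

theorem LowQ.arctan {f : α → ℝ} (hf : LowQ f) : LowR (fun a => Real.arctan (f a)) := by
  obtain ⟨p, q, d, hp, hq, hd, e⟩ := hf.exists_reduced
  refine ((hp.arctan_div hd fun a => (e a).1).sub (hq.arctan_div hd fun a => (e a).1)).congr
    fun a => ?_
  obtain ⟨-, h0, h⟩ := e a
  rw [h]
  rcases h0 with h0 | h0 <;> simp [h0, neg_div, Real.arctan_neg]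

theorem LowR.pi : LowR (fun _ : α => Real.pi) :=
  (((LowQ.natCast 4).lowR).mul (LowQ.natCast 1).arctan).congr fun _ => by
    rw [Nat.cast_one, Real.arctan_one]; push_cast; ring

/-! ### Exponential, cosine and sine by bounded search -/

/-- With N = k + 1, the search is for the least i with log ((i+1)/N) ≥ F, and i/N approximates exp
F. The order of reals cannot be decided exactly, so the test compares a rational approximation with
-1/N; B bounds the search. -/
theorem LowR.exp {F : α → ℝ} {B : α → ℕ} (hF : LowR F) (hB : Low B)
    (h : ∀ a, Real.exp (F a) ≤ B a) : LowR (fun a => Real.exp (F a)) := by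
  have hH : LowR (fun w : (α × ℕ) × ℕ =>
      Real.log (w.2 + 1 : ℕ) - Real.log (w.1.2 + 1 : ℕ) - F w.1.1) :=
    (Low.snd.succ.log.sub ((Low.snd (α := α)).succ.log.fst)).sub hF.fst.fst
  obtain ⟨g, hg, e⟩ := hH
  have hd : LowMap (fun w : (α × ℕ) × ℕ => (w, w.1.2)) := LowMap.id.pair (Low.snd.subst LowMap.fst)
  have hp : LowPred (fun w : (α × ℕ) × ℕ => -(1 / (w.1.2 + 1 : ℕ) : ℝ) ≤ g (w, w.1.2)) :=
    (((LowQ.natCast 1).div (Low.snd (α := α)).succ.fst.lowQ).neg.congr fun w => by simp).le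
      (hg.subst hd)
  obtain ⟨s, hs, hs'⟩ := hp.exists_least (b := fun w : α × ℕ => (w.2 + 1) * B w.1 + 1)
    ((Low.snd.succ.mul hB.fst).succ)
  refine LowR.of_approx (hs.lowQ.div Low.snd.succ.lowQ) ((Low.const 2).mul hB).succ
    fun a k => ?_
  obtain ⟨h1, h2⟩ := hs' (a, k)
  set N : ℝ := ((k + 1 : ℕ) : ℝ) with hN
  have hN0 : 0 < N := by positivity
  -- Every i that satisfies the exact inequality passes the test. Hence s - 1, which fails, violates
  -- it, and the bound B yields an i that passes.
  have key : ∀ i : ℕ, Real.exp (F a) * N ≤ i + 1 → -(1 / N) ≤ g (((a, k), i), k) := by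
    intro i hi
    have h3 := abs_le.mp (e ((a, k), i) k)
    have h4 : 0 ≤ Real.log (i + 1 : ℕ) - Real.log N - F a := by
      have := Real.log_le_log (by positivity) hi
      rw [Real.log_mul (Real.exp_pos _).ne' hN0.ne', Real.log_exp] at this
      push_cast
      linarith
    have h5 : (1 : ℝ) / (k + 1) = 1 / N := by rw [hN]; push_cast; rfl
    rw [h5] at h3
    linarith [h3.1, h3.2]
  have hlow : (s (a, k) : ℝ) ≤ Real.exp (F a) * N := by
    rcases Nat.eq_zero_or_pos (s (a, k)) with h0 | h0
    · rw [h0, Nat.cast_zero]; positivity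
    · by_contra hc
      refine h1 (s (a, k) - 1) (by omega) (key _ ?_)
      push_cast [Nat.cast_sub h0]
      linarith
  have hex : -(1 / N) ≤ g (((a, k), s (a, k)), k) := by
    refine h2 ⟨(k + 1) * B a, Nat.lt_succ_self _, key _ ?_⟩
    have : Real.exp (F a) * N ≤ B a * N := by
      gcongr
      exact h a
    rw [hN] at *
    push_cast at *
    linarith
  have hup : Real.exp (F a) * (1 - 2 / N) ≤ (s (a, k) + 1) / N := by
    have h3 := abs_le.mp (e ((a, k), s (a, k)) k)
    have h5 : (1 : ℝ) / (k + 1) = 1 / N := by rw [hN]; push_cast; rfl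
    rw [h5] at h3
    -- Passing the test loses 1/N by its tolerance and 1/N by the approximation.
    have h6 : F a + (-(2 / N)) ≤ Real.log ((s (a, k) + 1) / N) := by
      rw [Real.log_div (by positivity) hN0.ne']
      have : (2 : ℝ) / N = 1 / N + 1 / N := by ring
      have h7 := h3.1
      have h8 := h3.2
      push_cast at h7 h8
      rw [hN] at *
      push_cast at *
      linarith
    have h7 := Real.exp_le_exp.mpr h6
    rw [Real.exp_log (by positivity), Real.exp_add] at h7
    refine le_trans ?_ h7
    gcongr
    linarith [Real.add_one_le_exp (-(2 / N))]
  have h9 := h a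
  have hlow' : (s (a, k) : ℝ) / N ≤ Real.exp (F a) := (div_le_iff₀ hN0).mpr hlow
  rw [abs_of_nonneg (by exact sub_nonneg.mpr hlow')]
  have h10 : Real.exp (F a) * (2 / N) ≤ B a * (2 / N) := by gcongr
  have h11 : ((2 * B a + 1 : ℕ) : ℝ) / (k + 1) = B a * (2 / N) + 1 / N := by
    rw [hN]; push_cast; ring
  rw [h11]
  rw [add_div] at hup
  linarith

/-- One index i = p' + (2N + 1) j' codes a grid point u = (p' - N)/N of [-1, 1] and a number of
turns j' - (B + 1). Removing the nearest multiple of 2π and dividing by 4 leaves an angle in [-π/4,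
π/4], whose tangent lies in [-1, 1]; arctan is 1-Lipschitz, so grid width 1/N costs 4/N. -/
theorem exists_four_arctan_add {θ : ℝ} {B N : ℕ} (hB : |θ| ≤ B) (hN : 1 ≤ N) :
    ∃ i < (2 * N + 1) * (2 * (B + 1) + 1),
      |4 * Real.arctan (((i % (2 * N + 1) : ℕ) - (N : ℝ)) / N) +
        2 * Real.pi * ((i / (2 * N + 1) : ℕ) - ((B + 1 : ℕ) : ℝ)) - θ| ≤ 4 / N := by
  have hN0 : (0 : ℝ) < N := by exact_mod_cast hN
  set j := round (θ / (2 * Real.pi)) with hj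
  have hpi := Real.pi_gt_three
  have h1 := abs_le.mp (abs_sub_round (θ / (2 * Real.pi)))
  rw [← hj] at h1
  have h2 : |θ / (2 * Real.pi)| ≤ B := by
    rw [abs_div, abs_of_pos (by positivity : 0 < 2 * Real.pi)]
    exact (div_le_self (abs_nonneg _) (by linarith)).trans hB
  rw [abs_le] at h2
  have hjB : -((B + 1 : ℕ) : ℤ) ≤ j ∧ j ≤ (B + 1 : ℕ) := by
    constructor
    · have : (-((B + 1 : ℕ) : ℤ) : ℝ) ≤ j := by push_cast; linarith [h1.2, h2.1]
      exact_mod_cast this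
    · have : (j : ℝ) ≤ ((B + 1 : ℕ) : ℤ) := by push_cast; linarith [h1.1, h2.2]
      exact_mod_cast this
  set φ := (θ - 2 * Real.pi * j) / 4 with hφ
  have hφ' : |φ| ≤ Real.pi / 4 := by
    have : φ = (Real.pi / 2) * (θ / (2 * Real.pi) - j) := by
      rw [hφ]; field_simp; ring
    rw [this, abs_mul, abs_of_pos (by positivity)]
    nlinarith [abs_le.mpr h1]
  rw [abs_le] at hφ'
  have ht : Real.arctan (Real.tan φ) = φ := Real.arctan_tan (by linarith) (by linarith)
  have ht1 : -1 ≤ Real.tan φ ∧ Real.tan φ ≤ 1 := by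
    refine ⟨Real.arctan_le_arctan_iff.mp ?_, Real.arctan_le_arctan_iff.mp ?_⟩
    · rw [ht, Real.arctan_neg, Real.arctan_one]
      exact hφ'.1
    · rw [ht, Real.arctan_one]
      exact hφ'.2
  set p := ⌊Real.tan φ * N⌋ with hp
  have hp1 := Int.floor_le (Real.tan φ * N)
  have hp2 := Int.lt_floor_add_one (Real.tan φ * N)
  rw [← hp] at hp1 hp2
  have hpN : -(N : ℤ) ≤ p ∧ p ≤ N := by
    constructor
    · rw [hp, Int.le_floor]; push_cast; nlinarith
    · have : (p : ℝ) ≤ (N : ℤ) := by push_cast; nlinarith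
      exact_mod_cast this
  obtain ⟨p', hp'⟩ := Int.eq_ofNat_of_zero_le (show 0 ≤ p + N by omega)
  obtain ⟨j', hj'⟩ := Int.eq_ofNat_of_zero_le (show 0 ≤ j + (B + 1 : ℕ) by omega)
  have hp'' : (p' : ℝ) = p + N := by exact_mod_cast hp'.symm
  have hj'' : (j' : ℝ) = j + (B + 1 : ℕ) := by exact_mod_cast hj'.symm
  have hpl : p' < 2 * N + 1 := by omega
  have hjl : j' < 2 * (B + 1) + 1 := by omega
  refine ⟨p' + (2 * N + 1) * j', ?_, ?_⟩
  · calc p' + (2 * N + 1) * j' < (2 * N + 1) * (j' + 1) := by rw [mul_add]; omega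
      _ ≤ _ := Nat.mul_le_mul_left _ hjl
  · rw [Nat.add_mul_mod_self_left, Nat.mod_eq_of_lt hpl, Nat.add_mul_div_left _ _ (by omega),
      Nat.div_eq_of_lt hpl, zero_add, hp'', hj'', add_sub_cancel_right, add_sub_cancel_right]
    have e : 4 * Real.arctan (p / N) + 2 * Real.pi * j - θ =
        4 * (Real.arctan (p / N) - Real.arctan (Real.tan φ)) := by
      rw [ht, hφ]; ring
    have hlip : |Real.arctan (p / N) - Real.arctan (Real.tan φ)| ≤ |p / N - Real.tan φ| := by
      have := Convex.norm_image_sub_le_of_norm_hasDerivWithin_le (f := Real.arctan)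
        (f' := fun x => 1 / (1 + x ^ 2)) (C := 1) (s := Set.univ) (x := Real.tan φ) (y := p / N)
        (fun x _ => (Real.hasDerivAt_arctan x).hasDerivWithinAt)
        (fun x _ => by
          rw [Real.norm_of_nonneg (by positivity), div_le_one (by positivity)]
          nlinarith [sq_nonneg x]) convex_univ trivial trivial
      simpa [Real.norm_eq_abs] using this
    have hcl : |p / N - Real.tan φ| ≤ 1 / N := by
      have : p / N - Real.tan φ = -((Real.tan φ * N - p) / N) := by field_simp; ring
      rw [this, abs_neg, abs_of_nonneg (div_nonneg (by linarith) hN0.le)]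
      gcongr
      linarith
    rw [e, abs_mul, abs_of_pos (by norm_num : (0 : ℝ) < 4)]
    calc 4 * |Real.arctan (p / N) - Real.arctan (Real.tan φ)| ≤ 4 * (1 / N) := by
          gcongr
          exact hlip.trans hcl
      _ = _ := by ring

theorem cos_four_arctan (u : ℝ) :
    Real.cos (4 * Real.arctan u) = 2 * (2 / (1 + u ^ 2) - 1) ^ 2 - 1 := by
  rw [show 4 * Real.arctan u = 2 * (2 * Real.arctan u) by ring, Real.cos_two_mul,
    Real.cos_two_mul, Real.cos_sq_arctan]
  ring

theorem sin_four_arctan (u : ℝ) :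
    Real.sin (4 * Real.arctan u) = 2 * (2 * (u / (1 + u ^ 2))) * (2 / (1 + u ^ 2) - 1) := by
  have h : Real.sin (2 * Real.arctan u) = 2 * (u / (1 + u ^ 2)) := by
    rw [Real.sin_two_mul, mul_assoc]
    have := Real.tan_mul_cos (Real.cos_arctan_pos u).ne'
    rw [← this, mul_assoc, ← sq, Real.cos_sq_arctan, Real.tan_arctan]
    ring
  rw [show 4 * Real.arctan u = 2 * (2 * Real.arctan u) by ring, Real.sin_two_mul, h,
    Real.cos_two_mul, Real.cos_sq_arctan]
  ring

/-- An angle is approximated modulo `2π` by a rational multiple-angle parameter. -/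
theorem LowR.exists_four_arctan {F : α → ℝ} (hF : LowR F) :
    ∃ u : α × ℕ → ℝ, LowQ u ∧ ∀ a k, ∃ j : ℤ,
      |4 * Real.arctan (u (a, k)) + j * (2 * Real.pi) - F a| ≤ 6 / (k + 1) := by
  obtain ⟨B, hB, hB'⟩ := hF.exists_bound
  have hN : Low (fun w : (α × ℕ) × ℕ => w.1.2 + 1) := (Low.snd (α := α)).succ.fst
  have hM : Low (fun w : (α × ℕ) × ℕ => 2 * (w.1.2 + 1) + 1) := ((Low.const 2).mul hN).succ
  have hu : LowQ (fun w : (α × ℕ) × ℕ =>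
      ((w.2 % (2 * (w.1.2 + 1) + 1) : ℕ) - ((w.1.2 + 1 : ℕ) : ℝ)) / (w.1.2 + 1 : ℕ)) :=
    ((Low.snd.mod hM).lowQ.sub hN.lowQ).div hN.lowQ
  have hH : LowR (fun w : (α × ℕ) × ℕ => 4 * Real.arctan
      (((w.2 % (2 * (w.1.2 + 1) + 1) : ℕ) - ((w.1.2 + 1 : ℕ) : ℝ)) / (w.1.2 + 1 : ℕ)) +
      2 * Real.pi * ((w.2 / (2 * (w.1.2 + 1) + 1) : ℕ) - ((B w.1.1 + 1 : ℕ) : ℝ)) - F w.1.1) :=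
    (((LowQ.natCast 4).lowR.mul hu.arctan).add (((LowQ.natCast 2).lowR.mul LowR.pi).mul
      ((Low.snd.div hM).lowQ.sub hB.succ.fst.fst.lowQ).lowR)).sub hF.fst.fst
  obtain ⟨g, hg, e⟩ := hH
  have hd : LowMap (fun w : (α × ℕ) × ℕ => (w, w.1.2)) := LowMap.id.pair (Low.snd.subst LowMap.fst)
  have hc : LowQ (fun w : (α × ℕ) × ℕ => (5 : ℝ) / (w.1.2 + 1 : ℕ)) :=
    (LowQ.natCast 5).div hN.lowQ
  -- The tolerance 5/(k+1) covers the grid error 4/(k+1) and the approximation error 1/(k+1) of g;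
  -- undoing the latter gives the final 6/(k+1).
  have hp : LowPred (fun w : (α × ℕ) × ℕ => |g (w, w.1.2)| ≤ (5 : ℝ) / (w.1.2 + 1 : ℕ)) :=
    ((hc.neg.le (hg.subst hd)).and ((hg.subst hd).le hc)).congr fun w => abs_le
  obtain ⟨s, hs, hs'⟩ := hp.exists_least
    (b := fun w : α × ℕ => (2 * (w.2 + 1) + 1) * (2 * (B w.1 + 1) + 1))
    (((Low.const 2).mul Low.snd.succ).succ.mul (((Low.const 2).mul hB.fst.succ).succ))
  refine ⟨_, hu.subst (LowMap.id.pair hs), fun a k => ?_⟩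
  refine ⟨((s (a, k) / (2 * (k + 1) + 1) : ℕ) : ℤ) - (B a + 1 : ℕ), ?_⟩
  have h5 : (1 : ℝ) / (k + 1) = 1 / (k + 1 : ℕ) := by push_cast; rfl
  have h2 := (hs' (a, k)).2 (by
    obtain ⟨i, hi, h⟩ := exists_four_arctan_add (hB' a) (show 1 ≤ k + 1 by omega)
    refine ⟨i, hi, ?_⟩
    have h3 := e ((a, k), i) k
    have h4 := abs_sub_abs_le_abs_sub (g (((a, k), i), k)) (4 * Real.arctan
      (((i % (2 * (k + 1) + 1) : ℕ) - ((k + 1 : ℕ) : ℝ)) / (k + 1 : ℕ)) +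
      2 * Real.pi * ((i / (2 * (k + 1) + 1) : ℕ) - ((B a + 1 : ℕ) : ℝ)) - F a)
    rw [abs_sub_comm (g _)] at h4
    have h6 : (5 : ℝ) / (k + 1 : ℕ) = 1 / (k + 1 : ℕ) + 4 / (k + 1 : ℕ) := by ring
    rw [h5] at h3
    dsimp only at h3 ⊢
    linarith)
  have h3 := e ((a, k), s (a, k)) k
  rw [h5] at h3
  dsimp only at h2 h3 ⊢
  have h4 := abs_sub_abs_le_abs_sub (4 * Real.arctan
      (((s (a, k) % (2 * (k + 1) + 1) : ℕ) - ((k + 1 : ℕ) : ℝ)) / (k + 1 : ℕ)) +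
      2 * Real.pi * ((s (a, k) / (2 * (k + 1) + 1) : ℕ) - ((B a + 1 : ℕ) : ℝ)) - F a)
      (g (((a, k), s (a, k)), k))
  have h6 : (6 : ℝ) / (k + 1) = 1 / (k + 1 : ℕ) + 5 / (k + 1 : ℕ) := by push_cast; ring
  rw [h6]
  refine le_trans (le_of_eq ?_) ((sub_le_iff_le_add.mp h4).trans (add_le_add h3 h2))
  rw [Int.cast_sub, Int.cast_natCast, Int.cast_natCast, mul_comm (2 * Real.pi)]

theorem LowR.cos {F : α → ℝ} (hF : LowR F) : LowR (fun a => Real.cos (F a)) := by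
  obtain ⟨u, hu, h⟩ := hF.exists_four_arctan
  have hc : LowQ (fun w => 2 / (1 + u w ^ 2) - 1) :=
    (((LowQ.natCast 2).div ((LowQ.natCast 1).add (hu.mul hu))).sub (LowQ.natCast 1)).congr
      fun w => by push_cast; rw [sq]
  refine LowR.of_approx (((LowQ.natCast 2).mul (hc.mul hc)).sub (LowQ.natCast 1)) (Low.const 6)
    fun a k => ?_
  obtain ⟨j, hj⟩ := h a k
  refine le_trans (le_of_eq ?_) ((Real.abs_cos_sub_cos_le _ _).trans hj)
  rw [Real.cos_add_int_mul_two_pi, cos_four_arctan, abs_sub_comm]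
  congr 1
  push_cast
  ring

theorem LowR.sin {F : α → ℝ} (hF : LowR F) : LowR (fun a => Real.sin (F a)) := by
  obtain ⟨u, hu, h⟩ := hF.exists_four_arctan
  have hd : LowQ (fun w => 1 + u w ^ 2) := ((LowQ.natCast 1).add (hu.mul hu)).congr
    fun w => by push_cast; rw [sq]
  have hc : LowQ (fun w => 2 / (1 + u w ^ 2) - 1) :=
    ((LowQ.natCast 2).div hd).sub (LowQ.natCast 1) |>.congr fun w => by push_cast; rfl
  refine LowR.of_approx (((LowQ.natCast 2).mul ((LowQ.natCast 2).mul (hu.div hd))).mul hc)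
    (Low.const 6) fun a k => ?_
  obtain ⟨j, hj⟩ := h a k
  refine le_trans (le_of_eq ?_) ((Real.abs_sin_sub_sin_le _ _).trans hj)
  rw [Real.sin_add_int_mul_two_pi, sin_four_arctan, abs_sub_comm]
  congr 1

/-! ### Rate of convergence in Gauss's formula -/

open Filter Topology

/-- The expression is the ratio of consecutive Gauss products. Its terms of order 1/n cancel,
leaving O(1/n²), stated as a difference that telescopes. -/
theorem norm_one_add_inv_cpow_mul_sub_one_le {z : ℂ} {R : ℝ} (hz : 0 ≤ z.re) (hR : ‖z‖ ≤ R)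
    {n : ℕ} (hn : 1 ≤ n) :
    ‖Complex.exp (z * Real.log ((n + 1 : ℝ) / n)) * ((n + 1) / (z + (n + 1))) - 1‖ ≤
      (2 * R ^ 2 * Real.exp R + R) * (1 / n - 1 / (n + 1)) := by
  have hn' : (1 : ℝ) ≤ n := by exact_mod_cast hn
  have hn0 : (0 : ℝ) < n := by linarith
  have hR0 : 0 ≤ R := (norm_nonneg z).trans hR
  set l := Real.log ((n + 1 : ℝ) / n) with hl
  have hpos : (0 : ℝ) < (n + 1) / n := by positivity
  have hl1 : l ≤ 1 / n := by
    have := Real.log_le_sub_one_of_pos hpos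
    have e : ((n + 1 : ℝ)) / n - 1 = 1 / n := by field_simp; ring
    rw [← hl, e] at this
    exact this
  have hl2 : 1 / (n + 1 : ℝ) ≤ l := by
    have := Real.one_sub_inv_le_log_of_pos hpos
    have e : 1 - ((n + 1 : ℝ) / n)⁻¹ = 1 / (n + 1) := by field_simp; ring
    rw [← hl, e] at this
    exact this
  have hl0 : 0 ≤ l := le_trans (by positivity) hl2
  have hden : (n + 1 : ℝ) ≤ ‖z + (n + 1)‖ := by
    refine le_trans ?_ (Complex.re_le_norm _)
    simp
    linarith
  have hne : z + ((n : ℂ) + 1) ≠ 0 := by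
    intro h
    rw [h, norm_zero] at hden
    linarith
  have hexp : ‖Complex.exp (z * l) - 1 - z * l‖ ≤ R ^ 2 * l ^ 2 * Real.exp R := by
    have h := Complex.norm_exp_sub_sum_le_norm_mul_exp (z * l) 2
    have hzl : ‖z * (l : ℂ)‖ = ‖z‖ * l := by
      rw [norm_mul, Complex.norm_real, Real.norm_of_nonneg hl0]
    have h1 : ‖z‖ * l ≤ R := by
      have : l ≤ 1 := hl1.trans (by rw [div_le_one hn0]; exact hn')
      calc ‖z‖ * l ≤ R * 1 := by gcongr
        _ = R := mul_one R
    rw [hzl] at h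
    calc ‖Complex.exp (z * l) - 1 - z * l‖ ≤ (‖z‖ * l) ^ 2 * Real.exp (‖z‖ * l) := by
          simpa [Finset.sum_range_succ, sub_sub] using h
      _ ≤ (R * l) ^ 2 * Real.exp R := by gcongr
      _ = _ := by ring
  have hD : (1 : ℝ) / n - 1 / (n + 1) = 1 / (n * (n + 1)) := by field_simp; ring
  have hl3 : l ^ 2 ≤ 2 * (1 / (n * (n + 1))) := by
    calc l ^ 2 ≤ (1 / n : ℝ) ^ 2 := by gcongr
      _ ≤ _ := by
        rw [div_pow, one_pow, ← mul_div_assoc, mul_one, div_le_div_iff₀ (by positivity) (by positivity)]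
        nlinarith
  have e : Complex.exp (z * l) * ((n + 1) / (z + (n + 1))) - 1 =
      ((Complex.exp (z * l) - 1 - z * l) + z * ((l : ℂ) - 1 / (n + 1))) *
        ((n + 1) / (z + (n + 1))) := by
    have : (n + 1 : ℂ) ≠ 0 := by exact_mod_cast Nat.succ_ne_zero n
    field_simp
    ring
  have hq : ‖((n : ℂ) + 1) / (z + (n + 1))‖ ≤ 1 := by
    rw [norm_div]
    refine div_le_one_of_le₀ ?_ (norm_nonneg _)
    refine le_trans (le_of_eq ?_) hden
    rw [← Nat.cast_succ, Complex.norm_natCast, Nat.cast_succ]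
  have hz2 : ‖z * ((l : ℂ) - 1 / (n + 1))‖ ≤ R * (1 / (n * (n + 1))) := by
    have : (l : ℂ) - 1 / (n + 1) = ((l - 1 / (n + 1) : ℝ) : ℂ) := by push_cast; rfl
    rw [norm_mul, this, Complex.norm_real, Real.norm_of_nonneg (by linarith)]
    gcongr
    linarith
  rw [e, norm_mul]
  calc _ ≤ (R ^ 2 * l ^ 2 * Real.exp R + R * (1 / (n * (n + 1)))) * 1 := by
        gcongr
        exact (norm_add_le _ _).trans (add_le_add hexp hz2)
    _ ≤ (R ^ 2 * (2 * (1 / (n * (n + 1)))) * Real.exp R + R * (1 / (n * (n + 1)))) * 1 := by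
        gcongr
    _ = _ := by rw [hD]; ring

theorem gammaSeq_succ {z : ℂ} {n : ℕ} (hn : 1 ≤ n) :
    Complex.GammaSeq z (n + 1) = Complex.GammaSeq z n *
      (Complex.exp (z * Real.log ((n + 1 : ℝ) / n)) * ((n + 1) / (z + (n + 1)))) := by
  have hn0 : (n : ℝ) ≠ 0 := by exact_mod_cast (by omega : n ≠ 0)
  have hn1 : (n + 1 : ℝ) ≠ 0 := by exact_mod_cast n.succ_ne_zero
  have hp : ((n + 1 : ℕ) : ℂ) ^ z =
      (n : ℂ) ^ z * Complex.exp (z * Real.log ((n + 1 : ℝ) / n)) := by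
    rw [Complex.cpow_def_of_ne_zero (by exact_mod_cast n.succ_ne_zero),
      Complex.cpow_def_of_ne_zero (by exact_mod_cast (by omega : n ≠ 0)), ← Complex.exp_add,
      Real.log_div hn1 hn0, ← Complex.ofReal_natCast, ← Complex.ofReal_natCast,
      ← Complex.ofReal_log (by positivity), ← Complex.ofReal_log (by positivity)]
    congr 1
    push_cast
    ring
  rw [Complex.GammaSeq, Complex.GammaSeq, Finset.prod_range_succ _ (n + 1), hp, Nat.factorial_succ]
  push_cast
  rw [div_mul_eq_mul_div, mul_div_assoc, mul_div_assoc]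
  field_simp

/-- Uniform rate of convergence in Gauss's limit formula. -/
theorem exists_norm_gamma_sub_gammaSeq_le (R : ℝ) :
    ∃ C : ℝ, ∀ z : ℂ, 1 ≤ z.re → ‖z‖ ≤ R → ∀ n : ℕ, 1 ≤ n →
      ‖Complex.Gamma z - Complex.GammaSeq z n‖ ≤ C / n ∧ ‖Complex.GammaSeq z n‖ ≤ C := by
  set K := 2 * R ^ 2 * Real.exp R + R with hK
  refine ⟨K * Real.exp (K * 2) + Real.exp (K * 2), fun z hz hR n hn => ?_⟩
  have hR0 : 0 ≤ R := (norm_nonneg z).trans hR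
  have hK0 : 0 ≤ K := by positivity
  have hstep : ∀ n : ℕ, 1 ≤ n → ‖Complex.GammaSeq z (n + 1) - Complex.GammaSeq z n‖ ≤
      ‖Complex.GammaSeq z n‖ * (K * (1 / n - 1 / (n + 1))) := by
    intro n hn
    rw [gammaSeq_succ hn, ← mul_sub_one, norm_mul]
    gcongr
    exact norm_one_add_inv_cpow_mul_sub_one_le (by linarith) hR hn
  -- Multiplying the ratios and using 1 + x ≤ exp x makes the exponents telescope.
  have hb : ∀ n : ℕ, 1 ≤ n → ‖Complex.GammaSeq z n‖ ≤ Real.exp (K * (2 - 1 / n)) := by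
    intro n hn
    induction n, hn using Nat.le_induction with
    | base =>
      have hz1 : 1 ≤ ‖z‖ := hz.trans (Complex.re_le_norm z)
      have hz2 : 1 ≤ ‖z + 1‖ := le_trans (by simp; linarith) (Complex.re_le_norm (z + 1))
      have : ‖Complex.GammaSeq z 1‖ ≤ 1 := by
        simp only [Complex.GammaSeq, Nat.cast_one, Complex.one_cpow, Nat.factorial_one,
          Finset.prod_range_succ, Finset.prod_range_zero, norm_div, norm_mul, norm_one, one_mul,
          Nat.cast_zero, add_zero]
        exact div_le_one_of_le₀ (by nlinarith) (by positivity)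
      refine this.trans (Real.one_le_exp ?_)
      norm_num
      exact hK0
    | succ n hn ih =>
      have hn' : (1 : ℝ) ≤ n := by exact_mod_cast hn
      have h1 := hstep n hn
      have h2 : ‖Complex.GammaSeq z (n + 1)‖ ≤
          ‖Complex.GammaSeq z n‖ * (K * (1 / n - 1 / (n + 1)) + 1) := by
        have := norm_le_norm_add_norm_sub' (Complex.GammaSeq z (n + 1)) (Complex.GammaSeq z n)
        linarith
      refine h2.trans ?_
      calc _ ≤ Real.exp (K * (2 - 1 / n)) * Real.exp (K * (1 / n - 1 / (n + 1))) := by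
            have : (1 : ℝ) / (n + 1) ≤ 1 / n :=
              one_div_le_one_div_of_le (by linarith) (by linarith)
            exact mul_le_mul ih (Real.add_one_le_exp _)
              (by nlinarith [mul_nonneg hK0 (sub_nonneg.mpr this)]) (Real.exp_pos _).le
        _ = _ := by rw [← Real.exp_add]; congr 1; push_cast; ring
  have hb' : ∀ n : ℕ, 1 ≤ n → ‖Complex.GammaSeq z n‖ ≤ Real.exp (K * 2) := by
    intro n hn
    refine (hb n hn).trans (Real.exp_le_exp.mpr ?_)
    gcongr
    simp
  have hdiff : ∀ m : ℕ, n ≤ m → ‖Complex.GammaSeq z m - Complex.GammaSeq z n‖ ≤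
      Real.exp (K * 2) * (K * (1 / n - 1 / m)) := by
    intro m hm
    induction m, hm using Nat.le_induction with
    | base => simp
    | succ m hm ih =>
      have h1 := hstep m (hn.trans hm)
      have h2 := norm_sub_le_norm_sub_add_norm_sub (Complex.GammaSeq z (m + 1))
        (Complex.GammaSeq z m) (Complex.GammaSeq z n)
      have hm1 : (1 : ℝ) ≤ m := by exact_mod_cast hn.trans hm
      have h3 : 0 ≤ K * (1 / m - 1 / (m + 1) : ℝ) :=
        mul_nonneg hK0 (sub_nonneg.mpr (one_div_le_one_div_of_le (by linarith) (by linarith)))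
      have h4 := mul_le_mul_of_nonneg_right (hb' m (hn.trans hm)) h3
      push_cast
      linarith
  have hn' : (1 : ℝ) ≤ n := by exact_mod_cast hn
  constructor
  · have ht : Tendsto (fun m => ‖Complex.GammaSeq z m - Complex.GammaSeq z n‖) atTop
        (𝓝 ‖Complex.Gamma z - Complex.GammaSeq z n‖) :=
      ((Complex.GammaSeq_tendsto_Gamma z).sub_const _).norm
    refine le_of_tendsto ht ?_
    filter_upwards [eventually_ge_atTop n] with m hm
    refine (hdiff m hm).trans ?_
    have : (0 : ℝ) ≤ 1 / m := by positivity
    calc Real.exp (K * 2) * (K * (1 / n - 1 / m)) ≤ Real.exp (K * 2) * (K * (1 / n)) := by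
          gcongr; linarith
      _ = K * Real.exp (K * 2) / n := by ring
      _ ≤ _ := by
        gcongr
        linarith [Real.exp_pos (K * 2)]
  · refine (hb' n hn).trans ?_
    have : 0 ≤ K * Real.exp (K * 2) := by positivity
    linarith

theorem exists_norm_gamma_le (R : ℝ) :
    ∃ C : ℝ, ∀ z : ℂ, 1 ≤ z.re → ‖z‖ ≤ R → ‖Complex.Gamma z‖ ≤ C := by
  obtain ⟨C, hC⟩ := exists_norm_gamma_sub_gammaSeq_le R
  refine ⟨C + C, fun z hz hR => ?_⟩
  obtain ⟨h1, h2⟩ := hC z hz hR 1 le_rfl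
  have := norm_le_norm_add_norm_sub' (Complex.Gamma z) (Complex.GammaSeq z 1)
  rw [Nat.cast_one, div_one] at h1
  linarith

/-! ### Γ at rational points -/

/-- The real part of a logarithm of `GammaSeq z n`. -/
noncomputable def logGammaSeqRe (z : ℂ) (n : ℕ) : ℝ :=
  z.re * Real.log n + ∑ j ∈ Finset.range n, Real.log (j + 1 : ℕ) -
    ∑ j ∈ Finset.range (n + 1), Real.log ((z.re + j) ^ 2 + z.im ^ 2) / 2

/-- The imaginary part of a logarithm of `GammaSeq z n`. -/
noncomputable def logGammaSeqIm (z : ℂ) (n : ℕ) : ℝ :=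
  z.im * Real.log n - ∑ j ∈ Finset.range (n + 1), Real.arctan (z.im / (z.re + j))

theorem exp_log_add_arctan_mul_I {w : ℂ} (hw : 0 < w.re) :
    Complex.exp ((Real.log (w.re ^ 2 + w.im ^ 2) / 2 : ℝ) +
      (Real.arctan (w.im / w.re) : ℝ) * Complex.I) = w := by
  have h0 : w ≠ 0 := fun h => by simp [h] at hw
  have h1 : Real.log (w.re ^ 2 + w.im ^ 2) / 2 = Real.log ‖w‖ := by
    have : w.re ^ 2 + w.im ^ 2 = ‖w‖ ^ 2 := by
      rw [← Complex.normSq_eq_norm_sq, Complex.normSq_apply]; ring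
    rw [this, Real.log_pow]; push_cast; ring
  have h2 : Real.arctan (w.im / w.re) = w.arg := by
    have h := abs_lt.mp (Complex.abs_arg_lt_pi_div_two_iff.mpr (Or.inl hw))
    rw [← Complex.tan_arg, Real.arctan_tan h.1 h.2]
  rw [h1, h2]
  exact Complex.exp_log h0

/-- All factors z + j lie in the right half-plane, where the argument is arctan (y/x). Only the
exponential of the sum matters, so the branch of the total logarithm plays no role. -/
theorem gammaSeq_eq_exp {z : ℂ} (hz : 0 < z.re) {n : ℕ} (hn : 1 ≤ n) :
    Complex.GammaSeq z n = Complex.exp (logGammaSeqRe z n + logGammaSeqIm z n * Complex.I) := by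
  have h1 : (n : ℂ) ^ z = Complex.exp ((Real.log n : ℝ) * z) := by
    rw [Complex.cpow_def_of_ne_zero (by exact_mod_cast (by omega : n ≠ 0)),
      ← Complex.ofReal_natCast, ← Complex.ofReal_log (by positivity)]
  have h2 : (n.factorial : ℂ) =
      Complex.exp ((∑ j ∈ Finset.range n, Real.log (j + 1 : ℕ) : ℝ)) := by
    rw [← Finset.prod_range_add_one_eq_factorial, Complex.ofReal_sum, Complex.exp_sum]
    push_cast
    refine Finset.prod_congr rfl fun j _ => ?_
    rw [← Complex.ofReal_exp, Real.exp_log (by positivity)]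
    push_cast
    rfl
  have h3 : ∏ j ∈ Finset.range (n + 1), (z + j) =
      Complex.exp ((∑ j ∈ Finset.range (n + 1), Real.log ((z.re + j) ^ 2 + z.im ^ 2) / 2 : ℝ) +
        (∑ j ∈ Finset.range (n + 1), Real.arctan (z.im / (z.re + j)) : ℝ) * Complex.I) := by
    rw [Complex.ofReal_sum, Complex.ofReal_sum, Finset.sum_mul, ← Finset.sum_add_distrib,
      Complex.exp_sum]
    refine Finset.prod_congr rfl fun j _ => ?_
    have := exp_log_add_arctan_mul_I (w := z + j) (by simp; positivity)
    simpa using this.symm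
  rw [Complex.GammaSeq, h1, h2, h3, ← Complex.exp_add, ← Complex.exp_sub]
  congr 1
  apply Complex.ext <;>
    simp [logGammaSeqRe, logGammaSeqIm] <;> ring

theorem gammaSeq_re {z : ℂ} (hz : 0 < z.re) {n : ℕ} (hn : 1 ≤ n) :
    (Complex.GammaSeq z n).re = Real.exp (logGammaSeqRe z n) * Real.cos (logGammaSeqIm z n) := by
  rw [gammaSeq_eq_exp hz hn, Complex.exp_re]; simp

theorem gammaSeq_im {z : ℂ} (hz : 0 < z.re) {n : ℕ} (hn : 1 ≤ n) :
    (Complex.GammaSeq z n).im = Real.exp (logGammaSeqRe z n) * Real.sin (logGammaSeqIm z n) := by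
  rw [gammaSeq_eq_exp hz hn, Complex.exp_im]; simp

theorem exp_logGammaSeqRe {z : ℂ} (hz : 0 < z.re) {n : ℕ} (hn : 1 ≤ n) :
    Real.exp (logGammaSeqRe z n) = ‖Complex.GammaSeq z n‖ := by
  rw [gammaSeq_eq_exp hz hn, Complex.norm_exp]; simp

theorem LowQ.gamma_of_one_le_re {z : α → ℂ} (hre : LowQ fun a => (z a).re)
    (him : LowQ fun a => (z a).im) {R : ℝ} (h1 : ∀ a, 1 ≤ (z a).re) (hR : ∀ a, ‖z a‖ ≤ R) :
    LowR (fun a => (Complex.Gamma (z a)).re) ∧ LowR (fun a => (Complex.Gamma (z a)).im) := by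
  obtain ⟨C, hC⟩ := exists_norm_gamma_sub_gammaSeq_le R
  have hx : LowQ fun w : (α × ℕ) × ℕ => (z w.1.1).re + w.2 := hre.fst.fst.add Low.snd.lowQ
  have hy : LowQ fun w : (α × ℕ) × ℕ => (z w.1.1).im := him.fst.fst
  have hn : Low fun w : α × ℕ => w.2 + 1 := Low.snd.succ
  have hpos : ∀ w : (α × ℕ) × ℕ, 0 < (z w.1.1).re + w.2 := fun w => by
    have := h1 w.1.1
    positivity
  have hρ : LowR fun w : α × ℕ => logGammaSeqRe (z w.1) (w.2 + 1) := by
    have hq : LowQ fun w : (α × ℕ) × ℕ => ((z w.1.1).re + w.2) ^ 2 + (z w.1.1).im ^ 2 :=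
      ((hx.mul hx).add (hy.mul hy)).congr fun w => by rw [sq, sq]
    have hl := (hq.log fun w => by have := hpos w; positivity).mul
      ((LowQ.natCast 1).div (LowQ.natCast 2)).lowR
    have hf : LowR fun w : (α × ℕ) × ℕ => Real.log (w.2 + 1 : ℕ) := Low.snd.succ.log
    exact (((hre.fst.lowR.mul hn.log).add (hf.sum_range hn)).sub (hl.sum_range hn.succ)).congr
      fun w => by
        rw [logGammaSeqRe]
        congr 1
        refine Finset.sum_congr rfl fun j _ => ?_
        rw [Nat.cast_one, mul_one_div]
        rfl
  have hθ : LowR fun w : α × ℕ => logGammaSeqIm (z w.1) (w.2 + 1) :=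
    (him.fst.lowR.mul hn.log).sub ((hy.div hx).arctan.sum_range hn.succ)
  have hpos' : ∀ a, 0 < (z a).re := fun a => by linarith [h1 a]
  -- The exponential is the modulus of the Gauss product, bounded by C uniformly in n; this supplies
  -- the bound needed for the search.
  have hexp : LowR fun w : α × ℕ => Real.exp (logGammaSeqRe (z w.1) (w.2 + 1)) :=
    hρ.exp (Low.const ⌈C⌉₊) fun w => by
      rw [exp_logGammaSeqRe (hpos' _) (by omega)]
      exact (hC _ (h1 _) (hR _) _ (by omega)).2.trans (Nat.le_ceil C)
  have hrate : ∀ a k, ‖Complex.Gamma (z a) - Complex.GammaSeq (z a) (k + 1)‖ ≤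
      (⌈C⌉₊ : ℝ) / (k + 1) := fun a k => by
    refine (hC _ (h1 a) (hR a) (k + 1) (by omega)).1.trans ?_
    push_cast
    gcongr
    exact Nat.le_ceil C
  refine ⟨LowR.of_lim (hexp.mul hθ.cos) (Low.const ⌈C⌉₊) fun a k => ?_,
    LowR.of_lim (hexp.mul hθ.sin) (Low.const ⌈C⌉₊) fun a k => ?_⟩
  · rw [← gammaSeq_re (hpos' a) (by omega), ← Complex.sub_re]
    exact (Complex.abs_re_le_norm _).trans (hrate a k)
  · rw [← gammaSeq_im (hpos' a) (by omega), ← Complex.sub_im]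
    exact (Complex.abs_im_le_norm _).trans (hrate a k)

/-- Induction on the number of shifts through Γ(z) = Γ(z+1)/z; z is exactly rational, so its inverse
is too. -/
theorem LowQ.gamma {R : ℝ} (m : ℕ) {z : α → ℂ} (hre : LowQ fun a => (z a).re)
    (him : LowQ fun a => (z a).im) (h0 : ∀ a, ∀ n : ℕ, z a ≠ -n) (h1 : ∀ a, 1 ≤ (z a).re + m)
    (hR : ∀ a, ‖z a + m‖ ≤ R) :
    LowR (fun a => (Complex.Gamma (z a)).re) ∧ LowR (fun a => (Complex.Gamma (z a)).im) := by
  induction m generalizing z with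
  | zero => exact LowQ.gamma_of_one_le_re hre him (by simpa using h1) (by simpa using hR)
  | succ m ih =>
    have hre' : LowQ fun a => (z a + 1).re :=
      (hre.add (LowQ.natCast 1)).congr fun a => by simp
    have him' : LowQ fun a => (z a + 1).im := him.congr fun a => by simp
    obtain ⟨hA, hB⟩ := ih hre' him'
      (fun a n h => h0 a (n + 1) (by push_cast; rw [neg_add, ← h]; ring))
      (fun a => by have := h1 a; push_cast at this; simp; linarith)
      (fun a => by have := hR a; push_cast at this; rwa [add_assoc, add_comm 1])
    have hN : LowQ fun a => Complex.normSq (z a) :=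
      ((hre.mul hre).add (him.mul him)).congr fun a => Complex.normSq_apply _
    have e : ∀ a, Complex.Gamma (z a) = Complex.Gamma (z a + 1) / z a := fun a => by
      have : z a ≠ 0 := by simpa using h0 a 0
      rw [Complex.Gamma_add_one _ this, mul_div_cancel_left₀ _ this]
    have hu := (hre.div hN).lowR
    have hv := (him.div hN).lowR
    constructor
    · refine ((hA.mul hu).add (hB.mul hv)).congr fun a => ?_
      rw [e, Complex.div_re]
      ring
    · refine ((hB.mul hu).sub (hA.mul hv)).congr fun a => ?_
      rw [e, Complex.div_im]
      ring

/-! ### Encodings of rational numbers -/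

theorem Low.dvd {f g : α → ℕ} (hf : Low f) (hg : Low g) : LowPred (fun a => f a ∣ g a) :=
  (hg.mod hf).eq_zero.congr fun _ => Nat.dvd_iff_mod_eq_zero

theorem Low.gcd {f g : α → ℕ} (hf : Low f) (hg : Low g) (h : ∀ a, 0 < g a) :
    Low (fun a => Nat.gcd (f a) (g a)) := by
  -- The largest common divisor is g - s for the least suitable s.
  have hd : Low (fun w : α × ℕ => g w.1 - w.2) := hg.fst.sub Low.snd
  obtain ⟨s, hs, e⟩ := ((hd.dvd hf.fst).and (hd.dvd hg.fst)).exists_least hg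
  refine (hg.sub hs).congr fun a => ?_
  obtain ⟨h1, h2⟩ := e a
  dsimp only at h1 h2
  have hle := Nat.gcd_le_right (f a) (h a)
  have hpos := Nat.gcd_pos_of_pos_right (f a) (h a)
  have e0 : g a - (g a - Nat.gcd (f a) (g a)) = Nat.gcd (f a) (g a) := by omega
  have hmem : g a - (g a - Nat.gcd (f a) (g a)) ∣ f a ∧
      g a - (g a - Nat.gcd (f a) (g a)) ∣ g a := by
    rw [e0]
    exact ⟨Nat.gcd_dvd_left _ _, Nat.gcd_dvd_right _ _⟩
  have h3 := h2 ⟨_, by omega, hmem⟩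
  have h4 := Nat.le_of_dvd hpos (Nat.dvd_gcd h3.1 h3.2)
  have h5 : s a ≤ g a - Nat.gcd (f a) (g a) := by
    by_contra hc
    exact h1 _ (not_le.mp hc) hmem
  omega

theorem num_natCast_div (a : ℕ) {d : ℕ} (hd : 0 < d) :
    ((a : ℚ) / d).num = (a / Nat.gcd a d : ℕ) ∧ ((a : ℚ) / d).den = d / Nat.gcd a d := by
  have hg := Nat.gcd_pos_of_pos_right a hd
  have hc : Nat.Coprime (a / Nat.gcd a d) (d / Nat.gcd a d) := Nat.coprime_div_gcd_div_gcd hg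
  have hd' : 0 < d / Nat.gcd a d := Nat.div_pos (Nat.gcd_le_right a hd) hg
  have e : (a : ℚ) / d = ((a / Nat.gcd a d : ℕ) : ℤ) / ((d / Nat.gcd a d : ℕ) : ℤ) := by
    have hg' : (Nat.gcd a d : ℚ) ≠ 0 := by exact_mod_cast hg.ne'
    rw [Int.cast_natCast, Int.cast_natCast, Nat.cast_div (Nat.gcd_dvd_left a d) hg',
      Nat.cast_div (Nat.gcd_dvd_right a d) hg']
    have : (d : ℚ) ≠ 0 := by exact_mod_cast hd.ne'
    field_simp
  rw [e]
  refine ⟨Rat.num_div_eq_of_coprime (by exact_mod_cast hd') hc, ?_⟩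
  have := Rat.den_div_eq_of_coprime (a := ((a / Nat.gcd a d : ℕ) : ℤ))
    (b := ((d / Nat.gcd a d : ℕ) : ℤ)) (by exact_mod_cast hd') hc
  exact_mod_cast this

theorem ratEncode_ratDecode {v : Fin 3 → ℕ} (hv : 0 < v 2) :
    ratEncode (ratDecode v) = ![(v 0 - v 1) / Nat.gcd ((v 0 - v 1) + (v 1 - v 0)) (v 2),
      (v 1 - v 0) / Nat.gcd ((v 0 - v 1) + (v 1 - v 0)) (v 2),
      v 2 / Nat.gcd ((v 0 - v 1) + (v 1 - v 0)) (v 2)] := by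
  rw [ratDecode, if_pos hv, ratEncode]
  rcases le_total (v 1) (v 0) with h | h
  · obtain ⟨h1, h2⟩ := num_natCast_div (v 0 - v 1) hv
    rw [← Nat.cast_sub h, h1, h2, Nat.sub_eq_zero_of_le h]
    simp only [Nat.zero_div, add_zero, Int.toNat_natCast, Int.toNat_neg_natCast]
  · obtain ⟨h1, h2⟩ := num_natCast_div (v 1 - v 0) hv
    rw [← neg_sub, neg_div, ← Nat.cast_sub h, Rat.num_neg_eq_neg_num, Rat.den_neg_eq_den, h1, h2,
      Nat.sub_eq_zero_of_le h]
    simp only [Nat.zero_div, zero_add, Int.toNat_natCast, Int.toNat_neg_natCast, neg_neg]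

/-- Encoding requires lowest terms, hence the gcd. A zero denominator, decoded as 0, is treated
separately and replaced by 1 inside the gcd. -/
theorem Low.ratEncode_ratDecode {p q d : α → ℕ} (hp : Low p) (hq : Low q) (hd : Low d)
    (k : Fin 3) : Low (fun a => ratEncode (ratDecode ![p a, q a, d a]) k) := by
  classical
  have hd1 : Low (fun a => if d a = 0 then 1 else d a) := Low.ite hd.eq_zero (Low.const 1) hd
  have hg := Low.gcd ((hp.sub hq).add (hq.sub hp)) hd1 fun a => by
    split_ifs <;> omega
  have h0 : Low (fun _ : α => ratEncode 0 k) := Low.const _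
  have h1 : Low (fun a => ![(p a - q a) /
      Nat.gcd ((p a - q a) + (q a - p a)) (if d a = 0 then 1 else d a),
      (q a - p a) / Nat.gcd ((p a - q a) + (q a - p a)) (if d a = 0 then 1 else d a),
      d a / Nat.gcd ((p a - q a) + (q a - p a)) (if d a = 0 then 1 else d a)] k) := by
    fin_cases k
    · exact (hp.sub hq).div hg
    · exact (hq.sub hp).div hg
    · exact hd.div hg
  refine (Low.ite hd.eq_zero h0 h1).congr fun a => ?_
  by_cases h : d a = 0
  · simp [h, ratDecode]
  · rw [if_neg h, if_neg h, LowElem.ratEncode_ratDecode (by simpa using Nat.pos_of_ne_zero h)]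
    rfl

/-- Rational tuples, described by their encodings. -/
instance Context.rat (N : ℕ) : Context (Fin N → ℚ) :=
  ⟨3 * N, fun q i => ratEncode (q ⟨i.1 / 3, by omega⟩) ⟨i.1 % 3, by omega⟩⟩

/-- With the coordinates of the ambient type, being `Low` on a subset means agreeing there with a
total lower elementary function. The subset itself need not be decidable. -/
instance Context.subtype (p : α → Prop) : Context {a // p a} := ⟨dim α, fun a => coord a.1⟩

theorem LowMap.val (p : α → Prop) : LowMap (Subtype.val : {a // p a} → α) :=
  fun i => ⟨_, .proj i, fun _ => rfl⟩

theorem LowQ.ratCast {N : ℕ} (i : Fin N) : LowQ (fun q : Fin N → ℚ => (q i : ℝ)) := by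
  have key : ∀ k : Fin 3, Low (fun q : Fin N → ℚ => ratEncode (q i) k) := fun k =>
    (Low.coordinate (α := Fin N → ℚ) ⟨3 * i.1 + k.1, by
      show 3 * i.1 + k.1 < 3 * N
      omega⟩).congr fun q => by
        show _ = ratEncode (q ⟨(3 * i.1 + k.1) / 3, _⟩) ⟨(3 * i.1 + k.1) % 3, _⟩
        congr 2
        · ext
          show i.1 = (3 * i.1 + k.1) / 3
          omega
        · ext
          show k.1 = (3 * i.1 + k.1) % 3
          omega
  refine ⟨_, _, _, key 0, key 1, key 2, fun q => ⟨(q i).pos, ?_⟩⟩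
  have h : (((q i).num.toNat : ℝ) - ((-(q i).num).toNat : ℝ)) = ((q i).num : ℝ) := by
    exact_mod_cast Int.toNat_sub_toNat_neg (q i).num
  calc ((q i : ℚ) : ℝ) = (q i).num / (q i).den := by exact_mod_cast (Rat.num_div_den (q i)).symm
    _ = _ := by rw [← h]; rfl

theorem lowMap_ratTupleDecode (N : ℕ) :
    LowMap (fun v : Fin (3 * N + 1) → ℕ => (ratTupleDecode v : Fin N → ℚ)) := fun _ =>
  Low.ratEncode_ratDecode (Low.coordinate (α := Fin (3 * N + 1) → ℕ) _)
    (Low.coordinate (α := Fin (3 * N + 1) → ℕ) _) (Low.coordinate (α := Fin (3 * N + 1) → ℕ) _) _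

theorem Low.lowerElementary {n : ℕ} {f : (Fin n → ℕ) → ℕ} (hf : Low f) : LowerElementary f := by
  obtain ⟨g, hg, e⟩ := hf
  obtain rfl : f = g := funext e
  exact hg

theorem isLowRat_ratDecode {N M : ℕ} {g : Fin M → Fin 3 → (Fin N → ℚ) × ℕ → ℕ}
    (hg : ∀ j k, Low (g j k)) :
    IsLowRat (fun (a : Fin N → ℚ) (e : ℕ) (j : Fin M) =>
      ratDecode ![g j 0 (a, e), g j 1 (a, e), g j 2 (a, e)]) := by
  intro j k
  have hφ : LowMap (fun v : Fin (3 * N + 1) → ℕ =>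
      ((ratTupleDecode v : Fin N → ℚ), v (Fin.last (3 * N)))) :=
    (lowMap_ratTupleDecode N).pair (Low.coordinate (α := Fin (3 * N + 1) → ℕ) _)
  exact (Low.ratEncode_ratDecode ((hg j 0).subst hφ) ((hg j 1).subst hφ)
    ((hg j 2).subst hφ) k).lowerElementary

/-- A lower elementary function on a set of rational tuples extends to all rational tuples. -/
theorem Low.exists_extension {p : α → Prop} {f : {a // p a} × ℕ → ℕ} (hf : Low f) :
    ∃ g : α × ℕ → ℕ, Low g ∧ ∀ a k, f (a, k) = g (a.1, k) := by
  obtain ⟨G, hG, e⟩ := hf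
  exact ⟨fun w => G (coord (α := α × ℕ) w), ⟨G, hG, fun _ => rfl⟩, fun a k => e (a, k)⟩

/-- Sequences of reals that are lower elementary on a set of rational tuples have lower elementary
rational approximations defined everywhere. -/
theorem LowR.exists_isLowRat {N M : ℕ} {p : (Fin N → ℚ) → Prop}
    {F : {a : Fin N → ℚ // p a} → Fin M → ℝ} (hF : ∀ j, LowR fun a => F a j) {b : ℕ → ℕ}
    (hb : Low fun w : (Fin N → ℚ) × ℕ => b w.2) :
    ∃ f : (Fin N → ℚ) → ℕ → (Fin M → ℚ), IsLowRat f ∧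
      ∀ a e j, |F a j - f a.1 e j| ≤ 1 / (b e + 1) := by
  choose f hf e using hF
  choose P Q D hP hQ hD h using hf
  choose P' hP' eP using fun j => (hP j).exists_extension
  choose Q' hQ' eQ using fun j => (hQ j).exists_extension
  choose D' hD' eD using fun j => (hD j).exists_extension
  have hφ : LowMap (fun w : (Fin N → ℚ) × ℕ => (w.1, b w.2)) := LowMap.fst.pair hb
  refine ⟨_, isLowRat_ratDecode
    (g := fun j => ![fun w => P' j (w.1, b w.2), fun w => Q' j (w.1, b w.2),
      fun w => D' j (w.1, b w.2)]) fun j k => ?_, fun a i j => ?_⟩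
  · fin_cases k
    · exact (hP' j).subst hφ
    · exact (hQ' j).subst hφ
    · exact (hD' j).subst hφ
  · have h1 := e j a (b i)
    obtain ⟨h2, h3⟩ := h j (a, b i)
    rw [h3, eP, eQ, eD] at h1
    rw [eD] at h2
    convert h1 using 3
    simp [ratDecode, h2]

/-! ### Modulus of continuity away from the poles -/

/-- Each of the m divisions in the functional equation costs a factor 1/δ. -/
theorem norm_gamma_le_of_le_norm_add {C R δ : ℝ} (hδ : 0 < δ)
    (hC : ∀ z : ℂ, 1 ≤ z.re → ‖z‖ ≤ R → ‖Complex.Gamma z‖ ≤ C) (m : ℕ) {z : ℂ}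
    (h1 : 1 ≤ z.re + m) (hR : ‖z + m‖ ≤ R) (h0 : ∀ n : ℕ, δ ≤ ‖z + n‖) :
    ‖Complex.Gamma z‖ ≤ C * (1 / δ) ^ m := by
  induction m generalizing z with
  | zero => simpa using hC z (by simpa using h1) (by simpa using hR)
  | succ m ih =>
    have h := ih (z := z + 1) (by push_cast at h1; simp; linarith)
      (by push_cast at hR; rwa [add_assoc, add_comm 1])
      (fun n => by have := h0 (n + 1); push_cast at this; rwa [add_assoc, add_comm 1])
    have hz : δ ≤ ‖z‖ := by simpa using h0 0
    have hz0 : z ≠ 0 := norm_pos_iff.mp (hδ.trans_le hz)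
    rw [Complex.Gamma_add_one _ hz0, norm_mul] at h
    have : δ * ‖Complex.Gamma z‖ ≤ C * (1 / δ) ^ m :=
      (mul_le_mul_of_nonneg_right hz (norm_nonneg _)).trans h
    rw [pow_succ, ← mul_assoc, mul_one_div, le_div_iff₀ hδ, mul_comm]
    exact this

/-- A Lipschitz estimate for `Γ` near points with distance at least `2 δ` from the poles. -/
theorem norm_gamma_sub_gamma_le {C R δ : ℝ} (hδ : 0 < δ) (hδ1 : δ ≤ 1)
    (hC : ∀ z : ℂ, 1 ≤ z.re → ‖z‖ ≤ R → ‖Complex.Gamma z‖ ≤ C) (m : ℕ) {z w : ℂ}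
    (h1 : 2 ≤ z.re + m) (hR : ‖z + m‖ + 1 ≤ R) (h0 : ∀ n : ℕ, 2 * δ ≤ ‖z + n‖)
    (hw : ‖z - w‖ < δ) :
    ‖Complex.Gamma z - Complex.Gamma w‖ ≤ 2 * C * (1 / δ) ^ (m + 1) * ‖z - w‖ := by
  have hfar : ∀ u ∈ Metric.ball z δ, ∀ n : ℕ, δ ≤ ‖u + n‖ := by
    intro u hu n
    rw [mem_ball_iff_norm'] at hu
    have h2 := norm_sub_norm_le (z + n) (u + n)
    rw [add_sub_add_right_eq_sub] at h2
    linarith [h0 n]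
  have hb : ∀ u ∈ Metric.ball z δ, ‖Complex.Gamma u‖ ≤ C * (1 / δ) ^ m := by
    intro u hu
    have hu' := mem_ball_iff_norm'.mp hu
    refine norm_gamma_le_of_le_norm_add hδ hC m ?_ ?_ (hfar u hu)
    · have := (Complex.re_le_norm (z - u)).trans hu'.le
      rw [Complex.sub_re] at this
      linarith
    · have h2 := norm_sub_norm_le (u + m) (z + m)
      rw [add_sub_add_right_eq_sub, norm_sub_rev] at h2
      linarith
  have hd : DifferentiableOn ℂ Complex.Gamma (Metric.ball z δ) := fun u hu =>
    (Complex.differentiableAt_Gamma u fun n hn => by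
      have := hfar u hu n
      rw [hn, neg_add_cancel, norm_zero] at this
      linarith).differentiableWithinAt
  have hz := hb z (Metric.mem_ball_self hδ)
  -- A map from a disc of radius δ into one of radius 2C/δ^m is controlled by the Schwarz lemma,
  -- which divides by δ once more.
  have hmaps : Set.MapsTo Complex.Gamma (Metric.ball z δ)
      (Metric.closedBall (Complex.Gamma z) (2 * C * (1 / δ) ^ m)) := fun u hu => by
    rw [mem_closedBall_iff_norm]
    linarith [norm_sub_le (Complex.Gamma u) (Complex.Gamma z), hb u hu]
  have h := Complex.dist_le_div_mul_dist_of_mapsTo_ball hd hmaps (mem_ball_iff_norm'.mpr hw)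
  rw [dist_comm, dist_eq_norm, dist_comm, dist_eq_norm] at h
  refine h.trans (le_of_eq ?_)
  rw [pow_succ]
  ring

theorem norm_ofPlane_le (x : Fin 2 → ℝ) : ‖ofPlane x‖ ≤ 2 * ‖x‖ := by
  have h := Complex.norm_le_abs_re_add_abs_im (ofPlane x)
  have h0 : |x 0| ≤ ‖x‖ := norm_le_pi_norm x 0
  have h1 : |x 1| ≤ ‖x‖ := norm_le_pi_norm x 1
  have h2 : |(ofPlane x).re| + |(ofPlane x).im| = |x 0| + |x 1| := rfl
  linarith

theorem ofPlane_sub (x y : Fin 2 → ℝ) : ofPlane x - ofPlane y = ofPlane (x - y) := by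
  apply Complex.ext <;> simp [ofPlane]

theorem norm_toPlane_le (z : ℂ) : ‖toPlane z‖ ≤ ‖z‖ := by
  rw [pi_norm_le_iff_of_nonneg (norm_nonneg z)]
  intro i
  fin_cases i
  · exact Complex.abs_re_le_norm z
  · exact Complex.abs_im_le_norm z

theorem toPlane_ofPlane (x : Fin 2 → ℝ) : toPlane (ofPlane x) = x := by
  funext i
  fin_cases i <;> rfl

theorem toPlane_sub (z w : ℂ) : toPlane (z - w) = toPlane z - toPlane w := by
  funext i
  fin_cases i <;> simp [toPlane]

theorem one_div_le_norm_add_of_mem_exhaust {r : ℝ} {e : ℕ} {x : Fin 2 → ℝ}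
    (hx : x ∈ exhaust (ofPlane ⁻¹' ({z : ℂ | ‖z‖ < r} \ gammaPoles)) e) (n : ℕ) :
    1 / (e : ℝ) ≤ ‖ofPlane x + n‖ := by
  have h := hx.2.2 (toPlane (-(n : ℂ))) fun hmem => hmem.2 ⟨n, rfl⟩
  have e1 : x - toPlane (-(n : ℂ)) = toPlane (ofPlane x + n) := by
    rw [← sub_neg_eq_add, toPlane_sub, toPlane_ofPlane]
  rw [dist_eq_norm, e1] at h
  exact h.trans (norm_toPlane_le _)

end LowElem

/-! ### Γ on a punctured disc -/

open LowElem in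
theorem mainTheorem11 (r : ℝ) :
    LowElem.IsLowOnComplex ({z : ℂ | ‖z‖ < r} \ LowElem.gammaPoles) Complex.Gamma := by
  -- For |z| < r this gives Re z + m ≥ 2, leaving room for a nearby w with Re w + m ≥ 1.
  set m : ℕ := ⌈|r|⌉₊ + 2 with hm
  have hmr : |r| + 2 ≤ m := by
    rw [hm]; push_cast; linarith [Nat.le_ceil |r|]
  set R : ℝ := |r| + m + 1 with hR
  obtain ⟨C, hC⟩ := exists_norm_gamma_le R
  have hC0 : 0 ≤ C := (norm_nonneg _).trans (hC 1 (by simp) (by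
    rw [norm_one, hR]
    linarith [abs_nonneg r, (Nat.cast_nonneg m : (0 : ℝ) ≤ m)]))
  set A : ℕ := ⌈C⌉₊ with hA
  have hCA : C ≤ A := Nat.le_ceil C
  let pt : (Fin 2 → ℚ) → ℂ := fun a => ofPlane fun i => (a i : ℝ)
  let valid : (Fin 2 → ℚ) → Prop := fun a =>
    (∀ n : ℕ, pt a ≠ -n) ∧ 1 ≤ (pt a).re + m ∧ ‖pt a + m‖ ≤ R
  have hΓ := LowQ.gamma (α := {a // valid a}) (z := fun a => pt a.1) m
    ((LowQ.ratCast 0).subst (LowMap.val valid)) ((LowQ.ratCast 1).subst (LowMap.val valid))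
    (fun a => a.2.1) (fun a => a.2.2.1) (fun a => a.2.2.2)
  obtain ⟨f, hf, hfe⟩ := LowR.exists_isLowRat
    (F := fun a : {a // valid a} => toPlane (Complex.Gamma (pt a.1)))
    (fun j => by
      fin_cases j
      · exact hΓ.1
      · exact hΓ.2) (b := fun e => 2 * e) ((Low.const 2).mul Low.snd)
  -- Put q = 2e + 1. The Lipschitz constant is at most 2 (A + 1) q^(m+1), and passing from the
  -- maximum norm to the absolute value costs 2, so this d gives a continuity error of at most 1/q.
  -- The rational approximation at index 2e adds 1/q, and 2/q < 1/e.
  refine ⟨fun e => (4 * (A + 1)) * (2 * e + 1) ^ (m + 2), f, ?_, ?_, hf, ?_⟩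
  · refine StrictMono.const_mul (fun a b h => ?_) (by omega)
    exact Nat.pow_lt_pow_left (by omega) (by omega)
  · have h : Low (fun v : Fin 1 → ℕ => (4 * (A + 1)) * (2 * v 0 + 1) ^ (m + 2)) :=
      (Low.const (4 * (A + 1))).mul
        ((((Low.const 2).mul (Low.coordinate (α := Fin 1 → ℕ) 0)).succ).pow (m + 2))
    exact h.lowerElementary
  intro e he a x hx hxa
  have he' : (1 : ℝ) ≤ e := by exact_mod_cast he
  set z := ofPlane x with hz
  set w := pt a with hw
  have hzr : ‖z‖ < r := hx.1.1
  have hzr' : ‖z‖ < |r| := hzr.trans_le (le_abs_self r)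
  set δ : ℝ := 1 / (2 * e) with hδ
  have hδ0 : 0 < δ := by positivity
  have hδ1 : δ ≤ 1 / 2 := by
    rw [hδ, div_le_div_iff₀ (by positivity) (by norm_num)]
    linarith
  set q : ℝ := 2 * e + 1 with hq
  have hq1 : 1 ≤ q := by linarith
  have hzw : ‖z - w‖ ≤ 2 * (1 / (4 * (A + 1) * q ^ (m + 2))) := by
    rw [hz, hw, ofPlane_sub]
    refine (norm_ofPlane_le _).trans ?_
    push_cast at hxa
    linarith
  have hzw' : ‖z - w‖ ≤ 1 / q / 2 := by
    refine hzw.trans ?_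
    have : q ≤ (A + 1) * q ^ (m + 2) := by
      have h1 : (1 : ℝ) ≤ A + 1 := by linarith [(Nat.cast_nonneg A : (0 : ℝ) ≤ A)]
      have h2 : q ≤ q ^ (m + 2) := le_self_pow₀ hq1 (by omega)
      nlinarith
    rw [mul_assoc, div_div, mul_one_div, div_le_div_iff₀ (by positivity) (by positivity)]
    linarith
  have hqδ : 1 / q < δ := by
    rw [hδ, hq]
    exact one_div_lt_one_div_of_lt (by positivity) (by linarith)
  have hq0 : 0 < 1 / q := by positivity
  have hzwδ : ‖z - w‖ < δ := by linarith
  have h0 : ∀ n : ℕ, 2 * δ ≤ ‖z + n‖ := fun n => by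
    have := one_div_le_norm_add_of_mem_exhaust hx n
    rwa [show 2 * δ = 1 / e by rw [hδ]; field_simp]
  have hre : -|r| ≤ z.re := by
    linarith [(abs_le.mp (Complex.abs_re_le_norm z)).1]
  have hzm : ‖z + m‖ < |r| + m := by
    refine (norm_add_le _ _).trans_lt ?_
    rw [Complex.norm_natCast]
    linarith
  -- The approximation is only good at valid points, but a is closer to z than half the distance
  -- guaranteed between z and the poles.
  have hvalid : valid a := by
    refine ⟨fun n hn => ?_, ?_, ?_⟩
    · have h1 := h0 n
      have h2 : ‖z + n‖ = ‖z - w‖ := by rw [hw, hn, sub_neg_eq_add]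
      linarith
    · have := (Complex.re_le_norm (z - w)).trans hzwδ.le
      rw [Complex.sub_re] at this
      show 1 ≤ w.re + m
      linarith
    · show ‖w + m‖ ≤ R
      have h2 := norm_sub_norm_le (w + m) (z + m)
      rw [add_sub_add_right_eq_sub, norm_sub_rev] at h2
      linarith
  have hlip := norm_gamma_sub_gamma_le hδ0 (by linarith) hC m (by linarith) (by linarith) h0 hzwδ
  have hlip' : ‖Complex.Gamma z - Complex.Gamma w‖ ≤ 1 / q := by
    refine hlip.trans ?_
    have h1 : 1 / δ ≤ q := by rw [hδ, one_div_one_div]; linarith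
    calc 2 * C * (1 / δ) ^ (m + 1) * ‖z - w‖
        ≤ 2 * (A + 1) * q ^ (m + 1) * (2 * (1 / (4 * (A + 1) * q ^ (m + 2)))) := by
          gcongr
          linarith
      _ = 1 / q := by
        field_simp
        ring
  have hbd : 1 / q + 1 / q < 1 / (e : ℝ) := by
    have : 1 / (e : ℝ) = δ + δ := by rw [hδ]; field_simp; ring
    linarith
  refine (pi_norm_lt_iff (by positivity)).mpr fun j => ?_
  have h1 := hfe ⟨a, hvalid⟩ e j
  have h2 : |toPlane (Complex.Gamma z) j - toPlane (Complex.Gamma w) j| ≤ 1 / q := by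
    have := (norm_le_pi_norm (toPlane (Complex.Gamma z - Complex.Gamma w)) j).trans
      ((norm_toPlane_le _).trans hlip')
    rwa [toPlane_sub] at this
  push_cast at h1
  exact ((abs_sub_le _ _ _).trans (add_le_add h2 h1)).trans_lt hbd
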